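/- All graphs are finite, simple and undirected. A graph $G$ is $k$-connected ($k\ge 1$) if $|V(G)|>k$ and $G-T$ is connected for all $T\subseteq V(G)$ with $|T|<k$. An edge $e$ of a $3$-connected graph $G$ is called $3$-contractible if the graph $G/e$, obtained from $G$ by identifying the two endvertices of $e$ and simplifying the result, is $3$-connected. A DFS tree of $G$ is a spanning tree $Q$ of $G$ with a prescribed root $r$ such that, for every vertex $x$, any two distinct $x$-branches are nonadjacent in $G$, where an $x$-branch is the vertex set of a component of $Q-x$ not containing $r$. Theorem. Let $G$ be a $3$-connected graph that is not isomorphic to $K_4$. Then every DFS tree of $G$ contains at least one $3$-contractible edge of $G$. If, moreover, $G$ is isomorphic neither to the prism $K_3\times K_2$ (Cartesian product) nor to the graph $(K_3\times K_2)^+$ obtained from the prism by adding a single edge (unique up to isomorphism), then every DFS tree of $G$ contains at least two $3$-contractible edges of $G$. -/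

import Mathlib

namespace Foxes

/-- `G` is `k`-connected: it has more than `k` vertices (in particular, finitely many), and deleting
fewer than `k` vertices always leaves a connected graph. -/
def IsKConnected {V : Type*} (k : ℕ) (G : SimpleGraph V) : Prop :=
  k < Nat.card V ∧ ∀ T : Set V, T.ncard < k → (G.induce Tᶜ).Connected

/-- The equivalence relation on the vertices that identifies the two ends of `e`. -/
def contractSetoid {V : Type*} (e : Sym2 V) : Setoid V where
  r u v := u = v ∨ (u ∈ e ∧ v ∈ e)
  iseqv :=
    { refl := fun _ => Or.inl rfl
      symm := by
        rintro u v (h | h)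
        · exact Or.inl h.symm
        · exact Or.inr h.symm
      trans := by
        rintro u v w (rfl | h) (rfl | h')
        · exact Or.inl rfl
        · exact Or.inr h'
        · exact Or.inr h
        · exact Or.inr ⟨h.1, h'.2⟩ }

/-- The graph `G / e`: identify the two ends of `e`, then remove loops and parallel edges. -/
def contract {V : Type*} (G : SimpleGraph V) (e : Sym2 V) :
    SimpleGraph (Quotient (contractSetoid e)) where
  Adj a b := a ≠ b ∧ ∃ u v : V,
    Quotient.mk (contractSetoid e) u = a ∧ Quotient.mk (contractSetoid e) v = b ∧ G.Adj u v
  symm := ⟨fun _ _ ⟨hab, u, v, hu, hv, huv⟩ => ⟨hab.symm, v, u, hv, hu, huv.symm⟩⟩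
  loopless := ⟨fun _ h => h.1 rfl⟩

/-- `e` is an edge of `G` whose contraction gives a `k`-connected graph. (The notion is used only
for `k`-connected `G`.) -/
def IsContractible {V : Type*} (k : ℕ) (G : SimpleGraph V) (e : Sym2 V) : Prop :=
  e ∈ G.edgeSet ∧ IsKConnected k (contract G e)

/-- `B` is an `x`-branch of the tree `Q` with root `r`: the vertex set of a component of `Q - x`
that does not contain `r`. -/
def IsBranch {V : Type*} (Q : SimpleGraph V) (r x : V) (B : Set V) : Prop :=
  r ∉ B ∧ ∃ C : (Q.induce ({x}ᶜ : Set V)).ConnectedComponent, B = Subtype.val '' C.supp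

/-- `Q` is a DFS tree of `G` with root `r`: a spanning tree of `G` such that, for every vertex `x`,
any two distinct `x`-branches are nonadjacent in `G`. -/
structure IsDFSTree {V : Type*} (G Q : SimpleGraph V) (r : V) : Prop where
  le : Q ≤ G
  isTree : Q.IsTree
  not_adj : ∀ (x : V) (B₁ B₂ : Set V), IsBranch Q r x B₁ → IsBranch Q r x B₂ → B₁ ≠ B₂ →
    ∀ u ∈ B₁, ∀ v ∈ B₂, ¬ G.Adj u v

/-- The prism `K₃ × K₂` (Cartesian product). -/
def prism : SimpleGraph (Fin 3 × Fin 2) :=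
  (⊤ : SimpleGraph (Fin 3)).boxProd (⊤ : SimpleGraph (Fin 2))

/-- The prism plus one edge. The automorphism group of the prism acts transitively on the pairs of
nonadjacent vertices, so the choice of the new edge is immaterial. -/
def prismPlus : SimpleGraph (Fin 3 × Fin 2) :=
  prism ⊔ SimpleGraph.edge (0, 0) (1, 1)

end Foxes

namespace Foxes

/-! Call a pair solid if no separation of order three has both its vertices in the middle. On at
least five vertices, contracting a solid edge of a 3-connected graph leaves it 3-connected, so it
suffices to find solid edges in the tree. The tree enters only through its order: tree edges are
covering pairs, and edges of `G` join comparable vertices.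

One solid edge. Suppose that no tree edge is solid, and take a fragment minimal among those whose
middle contains a tree edge. Some tree edge leaves it, that edge lies in the middle of another
separation of order three, and uncrossing the two shrinks the fragment to one vertex of degree three
(`DFSOrder.exists_end`). A nonsolid edge at a vertex of degree three makes the other two neighbours
nonadjacent, so such a vertex is the root or a leaf adjacent to its grandparent
(`DFSOrder.end_eq_root_or_leaf`). Leaves are excluded by infinite descent (`DFSOrder.not_leaf_end`).
But both sides of a separation contain such a vertex, and the root is on one side only.

Two solid edges. Induct on the number of vertices and contract a solid tree edge `pq`. A tree edge
that becomes solid only by the contraction lies in the neighbourhood of `p` or `q`, and that vertex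
has degree three (`fragile_of_solid_edgeContract`, `Fragile.exists_adj_iff`). Let `pq` be the only
solid tree edge. Two such edges in the same neighbourhood form, after the contraction, a path with
adjacent ends; `HasTwoSolid` excludes these pairs so that the induction can proceed. One edge in
each neighbourhood forces the prism, possibly with an extra edge. The contraction itself cannot be
such a prism, because the solid edge recorded by `PrismOrder` lies in no triangle.

There remain two solid tree edges `ts`, `sp` with `t` and `p` adjacent. Contracting `sp` makes every
further neighbour of `s` a descendant of `s`; contracting `ts` makes it an ancestor of `t`. As `s`
has degree at least three, this is absurd. -/

/-- The vertex set is the disjoint union of `A`, `T` and `B`, the sets `A` and `B` are nonempty, and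
no edge joins `A` to `B`. -/
structure Separation {V : Type*} (G : SimpleGraph V) (A T B : Finset V) : Prop where
  left : A.Nonempty
  right : B.Nonempty
  cover : ∀ v, v ∈ A ∨ v ∈ T ∨ v ∈ B
  not_mem_mid : ∀ v ∈ A, v ∉ T
  not_mem_right : ∀ v ∈ A, v ∉ B
  right_not_mem_mid : ∀ v ∈ B, v ∉ T
  not_adj : ∀ u ∈ A, ∀ v ∈ B, ¬ G.Adj u v

/-- `3`-connectivity in terms of separations. -/
structure ThreeConnected {V : Type*} (G : SimpleGraph V) : Prop where
  four_le : 4 ≤ Nat.card V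
  three_le : ∀ A T B, Separation G A T B → 3 ≤ T.card

/-- No separation of order three has both `x` and `y` in its middle part. -/
def Solid {V : Type*} (G : SimpleGraph V) (x y : V) : Prop :=
  ∀ A T B, Separation G A T B → T.card = 3 → x ∈ T → y ∈ T → False

/-! ### Separations of order three and uncrossing. -/

section Separations

variable {V : Type*} {G : SimpleGraph V} {A T B A' T' B' : Finset V}

theorem Separation.symm (h : Separation G A T B) : Separation G B T A where
  left := h.right
  right := h.left
  cover v := by have := h.cover v; tauto
  not_mem_mid := h.right_not_mem_mid
  not_mem_right v hv hv' := h.not_mem_right v hv' hv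
  right_not_mem_mid := h.not_mem_mid
  not_adj u hu v hv huv := h.not_adj v hv u hu huv.symm

theorem Solid.symm {x y : V} (h : Solid G x y) : Solid G y x :=
  fun A T B hS hT hx hy => h A T B hS hT hy hx

theorem Separation.mem_or_mem (h : Separation G A T B) {u v : V} (hu : u ∈ A) (huv : G.Adj u v) :
    v ∈ A ∨ v ∈ T := by
  rcases h.cover v with hv | hv | hv
  · exact Or.inl hv
  · exact Or.inr hv
  · exact (h.not_adj u hu v hv huv).elim

/-- `A` may meet `T`: the sides of the separation are `A \ T` and the complement of `A ∪ T`. -/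
theorem ThreeConnected.three_le_card [Finite V] (hG : ThreeConnected G) (A : Set V) (T : Finset V)
    (h : ∀ x ∈ A, x ∉ T → ∀ y, G.Adj x y → y ∈ A ∨ y ∈ T)
    (hA : ∃ x ∈ A, x ∉ T) (hB : ∃ y, y ∉ A ∧ y ∉ T) : 3 ≤ T.card := by
  classical
  have := Fintype.ofFinite V
  apply hG.three_le (Finset.univ.filter fun x => x ∈ A ∧ x ∉ T) T
    (Finset.univ.filter fun x => x ∉ A ∧ x ∉ T)
  constructor
  · obtain ⟨x, hx⟩ := hA
    exact ⟨x, by simpa using hx⟩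
  · obtain ⟨x, hx⟩ := hB
    exact ⟨x, by simpa using hx⟩
  · intro v
    simp only [Finset.mem_filter, Finset.mem_univ, true_and]
    tauto
  · intro v
    simp only [Finset.mem_filter, Finset.mem_univ, true_and]
    tauto
  · intro v
    simp only [Finset.mem_filter, Finset.mem_univ, true_and]
    tauto
  · intro v
    simp only [Finset.mem_filter, Finset.mem_univ, true_and]
    tauto
  · intro u hu v hv huv
    simp only [Finset.mem_filter, Finset.mem_univ, true_and] at hu hv
    have := h u hu.1 hu.2 v huv
    tauto

theorem ThreeConnected.not_two_cut [Finite V] (hG : ThreeConnected G) (A : Set V) (s t : V)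
    (h : ∀ x ∈ A, x ≠ s → x ≠ t → ∀ y, G.Adj x y → y ∈ A ∨ y = s ∨ y = t)
    (hA : ∃ x ∈ A, x ≠ s ∧ x ≠ t) (hB : ∃ y, y ∉ A ∧ y ≠ s ∧ y ≠ t) : False := by
  classical
  have := hG.three_le_card A {s, t} (by simpa using h) (by simpa using hA) (by simpa using hB)
  have h2 : ({s, t} : Finset V).card ≤ 2 := Finset.card_le_two
  omega

theorem ThreeConnected.exists_ne [Finite V] (hG : ThreeConnected G) (a b c : V) :
    ∃ v, v ≠ a ∧ v ≠ b ∧ v ≠ c := by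
  classical
  have := Fintype.ofFinite V
  have h4 := hG.four_le
  rw [Nat.card_eq_fintype_card] at h4
  have : ({a, b, c} : Finset V).card < (Finset.univ : Finset V).card :=
    lt_of_le_of_lt Finset.card_le_three (by rw [Finset.card_univ]; omega)
  obtain ⟨v, -, hv⟩ := Finset.exists_mem_notMem_of_card_lt_card this
  exact ⟨v, by simpa using hv⟩

theorem exists_ne_of_five_le [Finite V] (h5 : 5 ≤ Nat.card V) (a b c d : V) :
    ∃ v, v ≠ a ∧ v ≠ b ∧ v ≠ c ∧ v ≠ d := by
  classical
  have := Fintype.ofFinite V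
  rw [Nat.card_eq_fintype_card] at h5
  have : ({a, b, c, d} : Finset V).card < (Finset.univ : Finset V).card :=
    lt_of_le_of_lt Finset.card_le_four (by rw [Finset.card_univ]; omega)
  obtain ⟨v, -, hv⟩ := Finset.exists_mem_notMem_of_card_lt_card this
  exact ⟨v, by simpa using hv⟩

theorem ThreeConnected.exists_adj_ne [Finite V] (hG : ThreeConnected G) (x a b : V) :
    ∃ c, G.Adj x c ∧ c ≠ a ∧ c ≠ b := by
  classical
  by_contra! hc
  obtain ⟨v, hv⟩ := hG.exists_ne x a b
  -- One of `a`, `b` may be `x` itself, so `x` is removed from the cut.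
  have := hG.three_le_card {x} (({a, b} : Finset V).erase x)
    (by
      rintro y rfl _ z hyz
      by_cases hza : z = a
      · simp [← hza, hyz.ne']
      · simp [hc z hyz hza, (hc z hyz hza) ▸ hyz.ne'])
    ⟨x, by simp⟩ ⟨v, by simp; tauto⟩
  have h1 := Finset.card_erase_le (s := ({a, b} : Finset V)) (a := x)
  have h2 : ({a, b} : Finset V).card ≤ 2 := Finset.card_le_two
  omega

/-- A vertex of `T` without a neighbour in `A` could be dropped from `T`, leaving a cut of order
two. -/
theorem Separation.exists_adj_left [Finite V] (hG : ThreeConnected G) (h : Separation G A T B)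
    (hT : T.card = 3) {x : V} (hx : x ∈ T) : ∃ u ∈ A, G.Adj x u := by
  classical
  by_contra! hc
  have := hG.three_le_card A (T.erase x)
    (by
      intro y hy _ z hyz
      rcases h.mem_or_mem hy hyz with hz | hz
      · exact Or.inl hz
      · refine Or.inr (Finset.mem_erase.2 ⟨?_, hz⟩)
        rintro rfl
        exact hc y hy hyz.symm)
    (by
      obtain ⟨y, hy⟩ := h.left
      exact ⟨y, hy, fun h' => h.not_mem_mid y hy (Finset.mem_of_mem_erase h')⟩)
    (by
      obtain ⟨y, hy⟩ := h.right
      exact ⟨y, fun h' => h.not_mem_right y h' hy,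
        fun h' => h.right_not_mem_mid y hy (Finset.mem_of_mem_erase h')⟩)
  rw [Finset.card_erase_of_mem hx] at this
  omega

theorem Separation.exists_adj_right [Finite V] (hG : ThreeConnected G) (h : Separation G A T B)
    (hT : T.card = 3) {x : V} (hx : x ∈ T) : ∃ u ∈ B, G.Adj x u :=
  h.symm.exists_adj_left hG hT hx

theorem Separation.adj_iff_of_singleton [Finite V] (hG : ThreeConnected G) {x : V}
    (h : Separation G {x} T B) (hT : T.card = 3) (v : V) : G.Adj x v ↔ v ∈ T := by
  constructor
  · intro hv
    rcases h.mem_or_mem (Finset.mem_singleton_self x) hv with h' | h'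
    · rw [Finset.mem_singleton] at h'
      exact (G.irrefl (h' ▸ hv)).elim
    · exact h'
  · intro hv
    obtain ⟨u, hu, huv⟩ := h.exists_adj_left hG hT hv
    rw [Finset.mem_singleton] at hu
    exact hu ▸ huv.symm

theorem Separation.corner [DecidableEq V] (h : Separation G A T B) (h' : Separation G A' T' B')
    (hne : (A ∩ A').Nonempty) :
    Separation G (A ∩ A') ((T ∩ A') ∪ ((T ∩ T') ∪ (A ∩ T'))) (B ∪ B') := by
  constructor
  · exact hne
  · exact h.right.mono Finset.subset_union_left
  · intro v
    have h1 := h.cover v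
    have h2 := h'.cover v
    simp only [Finset.mem_inter, Finset.mem_union]
    tauto
  · intro v
    have h1 := h.not_mem_mid v
    have h2 := h'.not_mem_mid v
    simp only [Finset.mem_inter, Finset.mem_union]
    tauto
  · intro v
    have h1 := h.not_mem_right v
    have h2 := h'.not_mem_right v
    simp only [Finset.mem_inter, Finset.mem_union]
    tauto
  · intro v
    have h1 := h.not_mem_right v
    have h2 := h'.not_mem_right v
    have h3 := h.right_not_mem_mid v
    have h4 := h'.right_not_mem_mid v
    simp only [Finset.mem_inter, Finset.mem_union]
    tauto
  · intro u hu v hv huv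
    simp only [Finset.mem_inter, Finset.mem_union] at hu hv
    rcases hv with hv | hv
    · exact h.not_adj u hu.1 v hv huv
    · exact h'.not_adj u hu.2 v hv huv

theorem Separation.card_inter [DecidableEq V] (h : Separation G A T B) (S : Finset V) :
    (A ∩ S).card + (T ∩ S).card + (B ∩ S).card = S.card := by
  rw [← Finset.card_union_of_disjoint, ← Finset.card_union_of_disjoint]
  · congr 1
    ext v
    have := h.cover v
    simp only [Finset.mem_inter, Finset.mem_union]
    tauto
  · rw [Finset.disjoint_left]
    intro v
    have h1 := h.not_mem_right v
    have h2 := h.right_not_mem_mid v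
    simp only [Finset.mem_inter, Finset.mem_union]
    tauto
  · rw [Finset.disjoint_left]
    intro v
    have h1 := h.not_mem_mid v
    simp only [Finset.mem_inter]
    tauto

theorem Separation.card_corner [DecidableEq V] (h : Separation G A T B)
    (h' : Separation G A' T' B') :
    ((T ∩ A') ∪ ((T ∩ T') ∪ (A ∩ T'))).card = (T ∩ A').card + (T ∩ T').card + (A ∩ T').card := by
  rw [Finset.card_union_of_disjoint, Finset.card_union_of_disjoint]
  · ring
  · rw [Finset.disjoint_left]
    intro v
    have h1 := h.not_mem_mid v
    simp only [Finset.mem_inter]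
    tauto
  · rw [Finset.disjoint_left]
    intro v
    have h1 := h.not_mem_mid v
    have h2 := h'.not_mem_mid v
    simp only [Finset.mem_inter, Finset.mem_union]
    tauto

/-- The middle of the corner contains `z` and `w`, and its left side loses `z`. If its order were
three, `A` would not be minimal. -/
theorem Separation.four_le_corner [DecidableEq V] (hG : ThreeConnected G)
    (h : Separation G A T B) (h' : Separation G A' T' B') {z w : V}
    (hzA : z ∈ A) (hzT' : z ∈ T') (hwT : w ∈ T) (hwT' : w ∈ T')
    (hmin : ∀ A₀ T₀ B₀, Separation G A₀ T₀ B₀ → T₀.card = 3 → z ∈ T₀ → w ∈ T₀ → ¬ A₀ ⊂ A)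
    (hne : (A ∩ A').Nonempty) : 4 ≤ (T ∩ A').card + (T ∩ T').card + (A ∩ T').card := by
  have hc := h.corner h' hne
  have h3 := hG.three_le _ _ _ hc
  rw [h.card_corner h'] at h3
  by_contra hlt
  refine hmin _ _ _ hc (by rw [h.card_corner h']; omega) ?_ ?_ ?_
  · simp [hzA, hzT']
  · simp [hwT, hwT']
  · refine ⟨Finset.inter_subset_left, fun hs => ?_⟩
    have := hs hzA
    exact h'.not_mem_mid z (Finset.mem_of_mem_inter_right this) hzT'

theorem Separation.three_le_corner [DecidableEq V] (hG : ThreeConnected G)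
    (h : Separation G A T B) (h' : Separation G A' T' B')
    (hne : (A ∩ A').Nonempty) : 3 ≤ (T ∩ A').card + (T ∩ T').card + (A ∩ T').card := by
  have h3 := hG.three_le _ _ _ (h.corner h' hne)
  rwa [h.card_corner h'] at h3

/-- The orders of opposite corners add up to six. A nonempty corner inside `A` has order at least
four, so the opposite one has order at most two and is empty. Counting then leaves `A` inside `T'`,
with a single element. -/
theorem Separation.card_eq_one_of_minimal (hG : ThreeConnected G)
    (h : Separation G A T B) (h' : Separation G A' T' B') (hT : T.card = 3) (hT' : T'.card = 3)
    {z w : V} (hzA : z ∈ A) (hzT' : z ∈ T') (hwT : w ∈ T) (hwT' : w ∈ T')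
    (hmin : ∀ A₀ T₀ B₀, Separation G A₀ T₀ B₀ → T₀.card = 3 → z ∈ T₀ → w ∈ T₀ → ¬ A₀ ⊂ A) :
    A.card = 1 := by
  classical
  have f1 := fun hne => h.four_le_corner hG h' hzA hzT' hwT hwT' hmin hne
  have f2 := fun hne => h.four_le_corner hG h'.symm hzA hzT' hwT hwT' hmin hne
  have f3 := fun hne => h.symm.three_le_corner hG h' hne
  have f4 := fun hne => h.symm.three_le_corner hG h'.symm hne
  have c1 := h'.card_inter A
  have c2 := h'.card_inter B
  have c3 := h'.card_inter T
  have c4 := h.card_inter A'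
  have c5 := h.card_inter B'
  have c6 := h.card_inter T'
  rw [Finset.inter_comm A' A, Finset.inter_comm T' A, Finset.inter_comm B' A] at c1
  rw [Finset.inter_comm A' B, Finset.inter_comm T' B, Finset.inter_comm B' B] at c2
  rw [Finset.inter_comm A' T, Finset.inter_comm T' T, Finset.inter_comm B' T] at c3
  have p1 : 0 < (A ∩ T').card := Finset.card_pos.2 ⟨z, by simp [hzA, hzT']⟩
  have p2 : 0 < (T ∩ T').card := Finset.card_pos.2 ⟨w, by simp [hwT, hwT']⟩
  have q1 := Finset.card_pos.2 h.left
  have q2 := Finset.card_pos.2 h.right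
  have q3 := Finset.card_pos.2 h'.left
  have q4 := Finset.card_pos.2 h'.right
  rw [← Finset.card_pos] at f1 f2 f3 f4
  omega

/-- A vertex of degree three in the middle of a separation of order three, together with one of its
neighbours: the other two neighbours lie on different sides. -/
theorem Separation.mem_sides [Finite V] (hG : ThreeConnected G) (h : Separation G A T B)
    (hT : T.card = 3) {x a b c : V} (hx : x ∈ T) (ha : a ∈ T)
    (hN : ∀ v, G.Adj x v ↔ v = a ∨ v = b ∨ v = c) :
    (b ∈ A ∧ c ∈ B) ∨ (b ∈ B ∧ c ∈ A) := by
  obtain ⟨u, hu, hxu⟩ := h.exists_adj_left hG hT hx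
  obtain ⟨v, hv, hxv⟩ := h.exists_adj_right hG hT hx
  rw [hN] at hxu hxv
  have h1 := h.not_mem_mid u hu
  have h2 := h.right_not_mem_mid v hv
  have h3 := h.not_mem_right
  rcases hxu with rfl | rfl | rfl <;> rcases hxv with rfl | rfl | rfl <;> simp_all

theorem exists_third (hT : T.card = 3) {a b : V} (ha : a ∈ T) (hb : b ∈ T) (hab : a ≠ b) :
    ∃ c, c ≠ a ∧ c ≠ b ∧ ∀ v, v ∈ T ↔ v = a ∨ v = b ∨ v = c := by
  classical
  have h1 : ((T.erase a).erase b).card = 1 := by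
    rw [Finset.card_erase_of_mem (Finset.mem_erase.2 ⟨hab.symm, hb⟩), Finset.card_erase_of_mem ha,
      hT]
  obtain ⟨c, hc⟩ := Finset.card_eq_one.1 h1
  have hc' : ∀ v, v ∈ (T.erase a).erase b ↔ v = c := by simp [hc]
  simp only [Finset.mem_erase] at hc'
  refine ⟨c, ((hc' c).2 rfl).2.1, ((hc' c).2 rfl).1, fun v => ?_⟩
  have := hc' v
  by_cases hva : v = a
  · simp [hva, ha]
  · by_cases hvb : v = b
    · simp [hvb, hb]
    · tauto

theorem exists_separation_of_not_solid [Finite V] (hG : ThreeConnected G) {x a b c : V}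
    (hxa : ¬ Solid G x a) (hN : ∀ v, G.Adj x v ↔ v = a ∨ v = b ∨ v = c) :
    ∃ w A T B, Separation G A T B ∧ T.card = 3 ∧ (∀ v, v ∈ T ↔ v = x ∨ v = a ∨ v = w) ∧
      w ≠ x ∧ w ≠ a ∧ b ∈ A ∧ c ∈ B := by
  classical
  have hne : x ≠ a := ((hN a).2 (Or.inl rfl)).ne
  unfold Solid at hxa
  push Not at hxa
  obtain ⟨A, T, B, hS, hT, hx, ha, -⟩ := hxa
  obtain ⟨w, hwx, hwa, hw⟩ := exists_third hT hx ha hne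
  rcases hS.mem_sides hG hT hx ha hN with h | h
  · exact ⟨w, A, T, B, hS, hT, hw, hwx, hwa, h⟩
  · exact ⟨w, B, T, A, hS.symm, hT, hw, hwx, hwa, h⟩

/-- A separation through `x` and `a` puts `b` and `c` on opposite sides, since `x` has neighbours on
both. This is the main tool for locating tree edges in neighbourhoods of size three. -/
theorem not_adj_of_not_solid [Finite V] (hG : ThreeConnected G) {x a b c : V}
    (hxa : ¬ Solid G x a) (hN : ∀ v, G.Adj x v ↔ v = a ∨ v = b ∨ v = c) : ¬ G.Adj b c := by
  obtain ⟨w, A, T, B, hS, -, -, -, -, hb, hc⟩ := exists_separation_of_not_solid hG hxa hN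
  exact hS.not_adj b hb c hc

/-- If `x` has degree three with neighbours `a`, `b`, `c`, then it can be exchanged for `b` in the
middle part `{x, a, w}` of a separation that has `b` on the left and `c` on the right. -/
theorem Separation.shift [DecidableEq V] (hS : Separation G A T B) {x a b c w : V}
    (hxa : x ≠ a) (hxw : x ≠ w) (hN : ∀ v, G.Adj x v ↔ v = a ∨ v = b ∨ v = c)
    (hT : ∀ v, v ∈ T ↔ v = x ∨ v = a ∨ v = w) (hb : b ∈ A) (hc : c ∈ B)
    (hAb : ∃ y ∈ A, y ≠ b) : Separation G (A.erase b) {b, a, w} (insert x B) := by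
  obtain ⟨y, hy, hyb⟩ := hAb
  have hmid := hS.not_mem_mid
  have hright := hS.not_mem_right
  have hmid' := hS.right_not_mem_mid
  have hxT : x ∈ T := (hT x).2 (by simp)
  have haT : a ∈ T := (hT a).2 (by simp)
  have hwT : w ∈ T := (hT w).2 (by simp)
  constructor
  · exact ⟨y, Finset.mem_erase.2 ⟨hyb, hy⟩⟩
  · exact Finset.insert_nonempty _ _
  · intro v
    have h1 := hS.cover v
    have h2 := hT v
    simp only [Finset.mem_erase, Finset.mem_insert, Finset.mem_singleton]
    tauto
  · intro v hv
    have h1 := hT v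
    have h2 := hmid v
    simp only [Finset.mem_erase, Finset.mem_insert, Finset.mem_singleton] at hv ⊢
    tauto
  · intro v hv
    have h1 := hT v
    have h2 := hmid v
    have h3 := hright v
    simp only [Finset.mem_erase, Finset.mem_insert] at hv ⊢
    tauto
  · intro v hv
    simp only [Finset.mem_insert, Finset.mem_singleton] at hv ⊢
    rintro (rfl | rfl | rfl)
    · rcases hv with rfl | hv
      · exact hmid _ hb hxT
      · exact hright _ hb hv
    · rcases hv with rfl | hv
      · exact hxa rfl
      · exact hmid' _ hv haT
    · rcases hv with rfl | hv
      · exact hxw rfl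
      · exact hmid' _ hv hwT
  · intro u hu v hv huv
    simp only [Finset.mem_erase, Finset.mem_insert] at hu hv
    rcases hv with rfl | hv
    · rcases (hN u).1 huv.symm with rfl | rfl | rfl
      · exact hmid _ hu.2 haT
      · exact hu.1 rfl
      · exact hright _ hu.2 hc
    · exact hS.not_adj u hu.2 v hv huv

end Separations

/-! ### Tree orders and minimal fragments. -/

/-- The partial order on the vertices is the tree order of a DFS tree of `G` with root `r`; the tree
edges are the covering pairs. -/
structure DFSOrder {V : Type*} [PartialOrder V] (G : SimpleGraph V) (r : V) : Prop where
  root_le : ∀ v, r ≤ v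
  chain : ∀ {u v w : V}, u ≤ w → v ≤ w → u ≤ v ∨ v ≤ u
  adj_of_covBy : ∀ {u v : V}, u ⋖ v → G.Adj u v
  comparable : ∀ {u v : V}, G.Adj u v → u ≤ v ∨ v ≤ u

section Order

set_option linter.unusedSectionVars false

variable {V : Type*} [PartialOrder V] [Finite V] {G : SimpleGraph V} {r : V}
  {A T B : Finset V}

theorem DFSOrder.le_of_lt_of_covBy (hD : DFSOrder G r) {u v w : V} (huv : u < v) (hwv : w ⋖ v) :
    u ≤ w := by
  rcases hD.chain huv.le hwv.le with h | h
  · exact h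
  · rcases h.lt_or_eq with h | h
    · exact (hwv.2 h huv).elim
    · exact h.ge

theorem DFSOrder.eq_of_covBy (hD : DFSOrder G r) {u v w : V} (huv : u ⋖ v) (hwv : w ⋖ v) :
    u = w :=
  le_antisymm (hD.le_of_lt_of_covBy huv.lt hwv) (hD.le_of_lt_of_covBy hwv.lt huv)

theorem DFSOrder.eq_or_lt (hD : DFSOrder G r) (v : V) : v = r ∨ r < v :=
  (hD.root_le v).eq_or_lt.imp_left Eq.symm

theorem DFSOrder.exists_covBy (hD : DFSOrder G r) {v : V} (hv : v ≠ r) : ∃ u, u ⋖ v := by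
  have h : r < v := (hD.eq_or_lt v).resolve_left hv
  obtain ⟨u, -, hu⟩ := exists_le_covBy_of_lt h
  exact ⟨u, hu⟩

/-- The tree path from `u` to `v` cannot leave `A` without meeting `T`. -/
theorem DFSOrder.mem_left_of_le (hD : DFSOrder G r) (hS : Separation G A T B) {u : V} (hu : u ∈ A)
    (v : V) (huv : u ≤ v) (h : ∀ x, u ≤ x → x ≤ v → x ∉ T) : v ∈ A := by
  induction v using WellFoundedLT.induction with
  | ind v ih =>
    rcases huv.eq_or_lt with rfl | hlt
    · exact hu
    · obtain ⟨w, huw, hwv⟩ := exists_le_covBy_of_lt hlt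
      have hw := ih w hwv.lt huw fun x hx hxw => h x hx (hxw.trans hwv.le)
      exact (hS.mem_or_mem hw (hD.adj_of_covBy hwv)).resolve_right (h v huv le_rfl)

theorem DFSOrder.mem_left_of_ge (hD : DFSOrder G r) (hS : Separation G A T B) {u v : V}
    (hv : v ∈ A) (huv : u ≤ v) (h : ∀ x, u ≤ x → x ≤ v → x ∉ T) : u ∈ A := by
  rcases hS.cover u with hu | hu | hu
  · exact hu
  · exact (h u le_rfl huv hu).elim
  · exact (hS.not_mem_right v hv (hD.mem_left_of_le hS.symm hu v huv h)).elim

/-- Otherwise membership in `A` passes along every tree edge, down to the root and from there to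
every vertex, including those of `B`. -/
theorem DFSOrder.exists_covBy_between (hD : DFSOrder G r) (hS : Separation G A T B) :
    ∃ z ∈ A, ∃ w ∈ T, z ⋖ w ∨ w ⋖ z := by
  by_contra! hc
  obtain ⟨a, ha⟩ := hS.left
  obtain ⟨b, hb⟩ := hS.right
  have down : ∀ v, v ∈ A → r ∈ A := by
    intro v
    induction v using WellFoundedLT.induction with
    | ind v ih =>
      intro hv
      rcases hD.eq_or_lt v with rfl | hlt
      · exact hv
      · obtain ⟨w, -, hwv⟩ := exists_le_covBy_of_lt hlt
        exact ih w hwv.lt ((hS.mem_or_mem hv (hD.adj_of_covBy hwv).symm).resolve_right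
          fun hw => (hc v hv w hw).2 hwv)
  have up : ∀ v, v ∈ A := by
    intro v
    induction v using WellFoundedLT.induction with
    | ind v ih =>
      rcases hD.eq_or_lt v with rfl | hlt
      · exact down a ha
      · obtain ⟨w, -, hwv⟩ := exists_le_covBy_of_lt hlt
        have hw := ih w hwv.lt
        exact (hS.mem_or_mem hw (hD.adj_of_covBy hwv)).resolve_right
          fun hv => (hc w hw v hv).1 hwv
  exact hS.not_mem_right b (up b) hb

/-- If no tree edge is solid, then every fragment whose neighbourhood contains a tree edge contains
a vertex of degree three whose neighbourhood contains a tree edge. -/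
theorem DFSOrder.exists_end (hG : ThreeConnected G) (hD : DFSOrder G r)
    (hN : ∀ u v : V, u ⋖ v → ¬ Solid G u v) (hS : Separation G A T B) (hT : T.card = 3)
    (huv : ∃ u ∈ T, ∃ v ∈ T, u ⋖ v) :
    ∃ x ∈ A, ∃ T₀ : Finset V, T₀.card = 3 ∧ (∀ v, G.Adj x v ↔ v ∈ T₀) ∧
      ∃ u ∈ T₀, ∃ v ∈ T₀, u ⋖ v := by
  induction A using Finset.strongInduction generalizing T B with
  | H A ih =>
    by_cases hmin : ∀ A₀ T₀ B₀, Separation G A₀ T₀ B₀ → T₀.card = 3 →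
        (∃ u ∈ T₀, ∃ v ∈ T₀, u ⋖ v) → ¬ A₀ ⊂ A
    -- For a minimal `A`, a separation through the nonsolid tree edge `zw` leaving `A` is uncrossed
    -- with the given one.
    · obtain ⟨z, hz, w, hw, hzw⟩ := hD.exists_covBy_between hS
      have : ∃ A' T' B', Separation G A' T' B' ∧ T'.card = 3 ∧ z ∈ T' ∧ w ∈ T' := by
        rcases hzw with h | h
        · have := hN _ _ h
          unfold Solid at this
          push Not at this
          obtain ⟨A', T', B', h1, h2, h3, h4, -⟩ := this
          exact ⟨A', T', B', h1, h2, h3, h4⟩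
        · have := hN _ _ h
          unfold Solid at this
          push Not at this
          obtain ⟨A', T', B', h1, h2, h3, h4, -⟩ := this
          exact ⟨A', T', B', h1, h2, h4, h3⟩
      obtain ⟨A', T', B', hS', hT', hz', hw'⟩ := this
      have h1 := hS.card_eq_one_of_minimal hG hS' hT hT' hz hz' hw hw'
        fun A₀ T₀ B₀ h0 hc0 hz0 hw0 => hmin A₀ T₀ B₀ h0 hc0 (by
          rcases hzw with h | h
          · exact ⟨z, hz0, w, hw0, h⟩
          · exact ⟨w, hw0, z, hz0, h⟩)
      obtain ⟨x, rfl⟩ := Finset.card_eq_one.1 h1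
      exact ⟨x, Finset.mem_singleton_self x, T, hT, hS.adj_iff_of_singleton hG hT, huv⟩
    · push Not at hmin
      obtain ⟨A₀, T₀, B₀, h0, hc0, he0, hlt⟩ := hmin
      obtain ⟨x, hx, h⟩ := ih A₀ hlt h0 hc0 he0
      exact ⟨x, hlt.1 hx, h⟩

end Order

/-! ### Existence of one solid tree edge. -/

section Ends

set_option linter.unusedSectionVars false

variable {V : Type*} [PartialOrder V] [Finite V] {G : SimpleGraph V} {r : V}

/-- Let `a` be the parent of `x`. A tree edge in `T₀` avoiding `a` would join the other two
neighbours of `x`, which are nonadjacent as `ax` is not solid; one starting at `a` would lead to a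
child of `a` incomparable with `x`. So it leads from some `b` to `a`. A child of `x` could only be
the third neighbour, and its nonsolid edge to `x` would forbid the edge `ba`. -/
theorem DFSOrder.end_eq_root_or_leaf (hG : ThreeConnected G) (hD : DFSOrder G r)
    (hN : ∀ u v : V, u ⋖ v → ¬ Solid G u v) {x : V} {T₀ : Finset V} (hT : T₀.card = 3)
    (hx : ∀ v, G.Adj x v ↔ v ∈ T₀) (huv : ∃ u ∈ T₀, ∃ v ∈ T₀, u ⋖ v) :
    x = r ∨ ∃ a b c, (∀ v, x ≤ v → v = x) ∧ b ⋖ a ∧ a ⋖ x ∧ c < b ∧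
      ∀ v, G.Adj x v ↔ v = a ∨ v = b ∨ v = c := by
  by_cases hxr : x = r
  · exact Or.inl hxr
  right
  obtain ⟨a, hax⟩ := hD.exists_covBy hxr
  have haT : a ∈ T₀ := (hx a).1 (hD.adj_of_covBy hax).symm
  obtain ⟨u, hu, v, hv, huv⟩ := huv
  have hxT : x ∉ T₀ := fun h => G.irrefl ((hx x).2 h)
  have key : ∃ b ∈ T₀, b ⋖ a := by
    by_cases hua : u = a
    · subst hua
      exfalso
      have hvx : v ≠ x := fun h => hxT (h ▸ hv)
      rcases hD.comparable ((hx v).2 hv) with h | h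
      · exact huv.2 hax.lt (lt_of_le_of_ne h hvx.symm)
      · exact absurd (hD.le_of_lt_of_covBy (lt_of_le_of_ne h hvx) hax) huv.lt.not_ge
    by_cases hva : v = a
    · exact ⟨u, hu, hva ▸ huv⟩
    exfalso
    obtain ⟨c, hca, hcu, hc⟩ := exists_third hT haT hu (Ne.symm hua)
    have hvc : v = c := by
      rcases (hc v).1 hv with h | h | h
      · exact (hva h).elim
      · exact (huv.ne h.symm).elim
      · exact h
    refine not_adj_of_not_solid hG (fun h => hN a x hax h.symm)
      (fun w => (hx w).trans (hc w)) ?_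
    exact hvc ▸ hD.adj_of_covBy huv
  obtain ⟨b, hb, hba⟩ := key
  obtain ⟨c, hca, hcb, hc⟩ := exists_third hT haT hb hba.ne'
  have hNx : ∀ v, G.Adj x v ↔ v = a ∨ v = b ∨ v = c := fun w => (hx w).trans (hc w)
  have hmax : ∀ v, x ≤ v → v = x := by
    intro v hv
    by_contra hne
    obtain ⟨y, hxy, -⟩ := exists_covBy_le_of_lt (lt_of_le_of_ne hv (Ne.symm hne))
    rcases (hNx y).1 (hD.adj_of_covBy hxy) with rfl | rfl | rfl
    · exact hxy.lt.asymm hax.lt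
    · exact hxy.lt.asymm (hba.lt.trans hax.lt)
    · refine not_adj_of_not_solid (b := b) (c := a) hG (hN x y hxy) (fun w => ?_) (hD.adj_of_covBy hba)
      rw [hNx]
      tauto
  have hcx : c ≠ x := by
    rintro rfl
    exact G.irrefl ((hNx c).2 (by simp))
  refine ⟨a, b, c, hmax, hba, hax, ?_, hNx⟩
  rcases hD.comparable ((hNx c).2 (by simp)) with h | h
  · exact (hcx (hmax c h)).elim
  · have h1 := hD.le_of_lt_of_covBy (lt_of_le_of_ne h hcx) hax
    have h2 := hD.le_of_lt_of_covBy (lt_of_le_of_ne h1 hca) hba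
    exact lt_of_le_of_ne h2 hcb

/-- The tree path from `c` to `b` changes sides, and of `T` it can only meet `w`. The path from `r`
to `c` therefore avoids `T`. -/
theorem DFSOrder.mid_between (hD : DFSOrder G r) {B T C : Finset V} (hS : Separation G B T C)
    {x a b c w : V} (hba : b < a) (hax : a < x) (hcb : c < b)
    (hT : ∀ v, v ∈ T ↔ v = x ∨ v = a ∨ v = w) (hb : b ∈ B) (hc : c ∈ C) :
    c < w ∧ w < b ∧ r ∈ C := by
  have h : c < w ∧ w < b := by
    by_contra hcon
    refine hS.not_mem_right b hb (hD.mem_left_of_le hS.symm hc b hcb.le fun t hct htb htT => ?_)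
    rcases (hT t).1 htT with rfl | rfl | rfl
    · exact (hba.trans hax).not_ge htb
    · exact hba.not_ge htb
    · refine hcon ⟨lt_of_le_of_ne hct ?_, lt_of_le_of_ne htb ?_⟩
      · rintro rfl
        exact hS.right_not_mem_mid _ hc htT
      · rintro rfl
        exact hS.not_mem_mid _ hb htT
  refine ⟨h.1, h.2, hD.mem_left_of_ge hS.symm hc (hD.root_le c) fun t _ htc htT => ?_⟩
  rcases (hT t).1 htT with rfl | rfl | rfl
  · exact (hcb.trans (hba.trans hax)).not_ge htc
  · exact (hcb.trans hba).not_ge htc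
  · exact h.1.not_ge htc

/-- As `T'` misses `C`, no edge joins `C ∩ B'` to `C ∩ C'`. If both are nonempty, the one on the
side of `T'` not containing `x` is cut off by the two vertices of `T` other than `x`. -/
theorem Separation.disjoint_of_mid_subset (hG : ThreeConnected G) {B T C B' T' C' : Finset V}
    (hS : Separation G B T C) (hS' : Separation G B' T' C') (hT : T.card = 3) {x s : V}
    (hx : x ∈ T) (hxT' : x ∉ T') (hCT' : ∀ v ∈ C, v ∉ T') (hs : s ∈ C) (hsC' : s ∈ C') :
    ∀ v ∈ C, v ∉ B' := by
  classical
  have key : ∀ {B' C' : Finset V}, Separation G B' T' C' → ∀ {u v}, u ∈ C → u ∈ B' → v ∈ C →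
      v ∈ C' → x ∉ C' := by
    intro B' C' hS' u v hu huB' hv hvC' hxC'
    have h3 := hG.three_le_card {y | y ∈ C ∧ y ∈ B'} (T.erase x)
      (by
        rintro y ⟨hyC, hyB'⟩ - z hyz
        rcases hS.symm.mem_or_mem hyC hyz with hz | hz
        · rcases hS'.mem_or_mem hyB' hyz with hz' | hz'
          · exact Or.inl ⟨hz, hz'⟩
          · exact (hCT' z hz hz').elim
        · refine Or.inr (Finset.mem_erase.2 ⟨?_, hz⟩)
          rintro rfl
          exact hS'.not_adj y hyB' _ hxC' hyz)
      ⟨u, ⟨hu, huB'⟩, fun h => hS.right_not_mem_mid u hu (Finset.mem_of_mem_erase h)⟩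
      ⟨v, fun h => hS'.not_mem_right v h.2 hvC',
        fun h => hS.right_not_mem_mid v hv (Finset.mem_of_mem_erase h)⟩
    rw [Finset.card_erase_of_mem hx] at h3
    omega
  intro v hv hvB'
  have h1 := key hS' hv hvB' hs hsC'
  have h2 := key hS'.symm hs hsC' hv hvB'
  rcases hS'.cover x with h | h | h
  · exact h2 h
  · exact hxT' h
  · exact h1 h

/-- Infinite descent on `B`. Exchanging `x` for `b` gives a separation with left side `B` minus `b`
and the tree edge `ba` in its middle, hence an end `y` on that side. The root is in `C`, so `y` is
again a leaf of the same kind. Its separation has its middle in `B ∪ {a}` and its left side `B'`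
inside `B`, properly because `y` lies in `B` but not in `B'`. -/
theorem DFSOrder.not_leaf_end (hG : ThreeConnected G) (hD : DFSOrder G r)
    (hN : ∀ u v : V, u ⋖ v → ¬ Solid G u v) (B : Finset V) :
    ∀ {T C : Finset V} {x a b c w : V}, Separation G B T C → T.card = 3 →
      (∀ v, x ≤ v → v = x) → b ⋖ a → a ⋖ x → c < b →
      (∀ v, G.Adj x v ↔ v = a ∨ v = b ∨ v = c) →
      (∀ v, v ∈ T ↔ v = x ∨ v = a ∨ v = w) → b ∈ B → c ∈ C → False := by
  classical
  induction B using Finset.strongInduction with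
  | H B ih =>
    intro T C x a b c w hS hTc hmax hba hax hcb hNx hT hb hc
    obtain ⟨hcw, hwb, hrC⟩ := hD.mid_between hS hba.lt hax.lt hcb hT hb hc
    have hxT : x ∈ T := (hT x).2 (by simp)
    have haT : a ∈ T := (hT a).2 (by simp)
    have hwT : w ∈ T := (hT w).2 (by simp)
    -- If `B = {b}`, then `w` is the parent of `b`, and as `wb` is not solid, `x` and `a` would be
    -- nonadjacent.
    have hBb : ∃ y ∈ B, y ≠ b := by
      by_contra! hcon
      have hB : B = {b} := Finset.eq_singleton_iff_unique_mem.2 ⟨hb, hcon⟩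
      have hNb := (hB ▸ hS).adj_iff_of_singleton hG hTc
      obtain ⟨u, -, hu⟩ := exists_le_covBy_of_lt hcb
      have huw : u = w := by
        rcases (hT u).1 ((hNb u).1 (hD.adj_of_covBy hu).symm) with rfl | rfl | h
        · exact (hu.lt.asymm (hba.lt.trans hax.lt)).elim
        · exact (hu.lt.asymm hba.lt).elim
        · exact h
      subst huw
      refine not_adj_of_not_solid (b := x) (c := a) hG (fun h => hN u b hu h.symm) (fun v => ?_)
        (hD.adj_of_covBy hax).symm
      rw [hNb, hT]
      tauto
    have hS₁ := hS.shift hax.ne' (hwb.trans (hba.lt.trans hax.lt)).ne' hNx hT hb hc hBb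
    have hcard : ({b, a, w} : Finset V).card = 3 := by
      rw [Finset.card_eq_three]
      exact ⟨b, a, w, hba.ne, hwb.ne', (hwb.trans hba.lt).ne', rfl⟩
    obtain ⟨y, hy, T₀, hT₀, hNy, hcov⟩ := hD.exists_end hG hN hS₁ hcard
      ⟨b, by simp, a, by simp, hba⟩
    rw [Finset.mem_erase] at hy
    obtain ⟨hyb, hyB⟩ := hy
    rcases hD.end_eq_root_or_leaf hG hN hT₀ hNy hcov with rfl | h
    · exact hS.not_mem_right _ hyB hrC
    obtain ⟨a', b', c', hmax', hba', hax', hcb', hNy'⟩ := h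
    obtain ⟨w', B', T', C', hS', hTc', hT', hwy', hwa', hb', hc'⟩ :=
      exists_separation_of_not_solid hG (fun h => hN a' y hax' h.symm) hNy'
    obtain ⟨hcw', hwb', hrC'⟩ := hD.mid_between hS' hba'.lt hax'.lt hcb' hT' hb' hc'
    have hyx : ¬ G.Adj y x := by
      intro h
      rcases (hNx y).1 h.symm with rfl | rfl | rfl
      · exact hS.not_mem_mid _ hyB haT
      · exact hyb rfl
      · exact hS.not_mem_right _ hyB hc
    -- The tree path from the root starts in `C` and meets `T` before reaching `v`. It cannot meet
    -- the leaf `x`, and `w` lies below `a`.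
    have hBw : ∀ v ∈ B, w < v := by
      intro v hv
      by_contra hwv
      refine hS.not_mem_right v hv
        (hD.mem_left_of_le hS.symm hrC v (hD.root_le v) fun t _ htv htT => ?_)
      rcases (hT t).1 htT with rfl | rfl | rfl
      · exact hS.not_mem_mid v hv ((hmax v htv).symm ▸ hxT)
      · exact hwv (hwb.trans (hba.lt.trans_le htv))
      · exact hwv (lt_of_le_of_ne htv fun h => hS.not_mem_mid v hv (h ▸ htT))
    have hnb : ∀ v, G.Adj y v → v ∈ B ∨ v = a ∨ v = w := by
      intro v hv
      rcases hS.mem_or_mem hyB hv with h | h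
      · exact Or.inl h
      · rcases (hT v).1 h with rfl | h | h
        · exact (hyx hv).elim
        · exact Or.inr (Or.inl h)
        · exact Or.inr (Or.inr h)
    have hwa : w < a := hwb.trans hba.lt
    have hwc' : w ≤ c' := by
      rcases hnb c' ((hNy' c').2 (by simp)) with h | rfl | rfl
      · exact (hBw _ h).le
      · exact hwa.le
      · exact le_rfl
    have hb'Ba : b' ∈ B ∨ b' = a := by
      rcases hnb b' ((hNy' b').2 (by simp)) with h | h | h
      · exact Or.inl h
      · exact Or.inr h
      · exact ((hwc'.trans_lt hcb').ne' h).elim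
    have ha'Ba : a' ∈ B ∨ a' = a := by
      rcases hnb a' ((hNy' a').2 (by simp)) with h | h | h
      · exact Or.inl h
      · exact Or.inr h
      · exact ((hwc'.trans_lt (hcb'.trans hba'.lt)).ne' h).elim
    have hww' : w < w' := hwc'.trans_lt hcw'
    have hxb' : ¬ x ≤ b' := by
      intro h
      have h2 := hmax a' (h.trans hba'.le)
      rw [← hmax b' h] at h2
      exact hba'.ne' h2
    have hw'Ba : w' ∈ B ∨ w' = a := by
      rcases hS.cover w' with h | h | h
      · exact Or.inl h
      · rcases (hT w').1 h with rfl | h | rfl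
        · exact (hxb' hwb'.le).elim
        · exact Or.inr h
        · exact hww'.ne rfl |>.elim
      -- From `w' ∈ C` the tree path to `b'` must meet `T`, necessarily in `a`. Then `w' ≤ b`
      -- already, and the path from `w'` to `b` avoids `T`.
      · exfalso
        have hb'C : b' ∉ C := by
          rcases hb'Ba with h | rfl
          · exact hS.not_mem_right _ h
          · exact fun h => hS.right_not_mem_mid _ h haT
        refine hb'C (hD.mem_left_of_le hS.symm h b' hwb'.le fun t hwt htb htT => ?_)
        rcases (hT t).1 htT with rfl | rfl | rfl
        · exact hxb' htb
        · have hw't : w' < t := lt_of_le_of_ne hwt fun h' =>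
            hS.right_not_mem_mid w' h (h' ▸ haT)
          have hw'b := hD.le_of_lt_of_covBy hw't hba
          refine hS.not_mem_right b hb (hD.mem_left_of_le hS.symm h b hw'b fun s hws hsb hsT => ?_)
          rcases (hT s).1 hsT with rfl | rfl | rfl
          · exact (hba.lt.trans hax.lt).not_ge hsb
          · exact hba.lt.not_ge hsb
          · exact hww'.not_ge hws
        · exact hww'.not_ge hwt
    have hT'Ba : ∀ v ∈ T', v ∈ B ∨ v = a := by
      intro v hv
      rcases (hT' v).1 hv with rfl | rfl | rfl
      · exact Or.inl hyB
      · exact ha'Ba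
      · exact hw'Ba
    have hxT' : x ∉ T' := by
      intro h
      rcases hT'Ba x h with h | h
      · exact hS.not_mem_mid x h hxT
      · exact hax.ne' h
    have hCT' : ∀ v ∈ C, v ∉ T' := by
      intro v hv h
      rcases hT'Ba v h with h | rfl
      · exact hS.not_mem_right v h hv
      · exact hS.right_not_mem_mid _ hv haT
    have hCB' := hS.disjoint_of_mid_subset hG hS' hTc hxT hxT' hCT' hrC hrC'
    have hsub : B' ⊆ B := by
      intro v hv
      rcases hS.cover v with h | h | h
      · exact h
      · exfalso
        obtain ⟨u, hu, hvu⟩ := hS.exists_adj_right hG hTc h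
        rcases hS'.mem_or_mem hv hvu with h' | h'
        · exact hCB' u hu h'
        · exact hCT' u hu h'
      · exact (hCB' v h hv).elim
    refine ih B' ⟨hsub, fun h => ?_⟩ hS' hTc' hmax' hba' hax' hcb' hNy' hT' hb' hc'
    exact hS'.not_mem_mid y (h hyB) ((hT' y).2 (by simp))

/-- Every DFS tree of a `3`-connected graph has a solid edge. -/
theorem DFSOrder.exists_solid (hG : ThreeConnected G) (hD : DFSOrder G r) :
    ∃ u v : V, u ⋖ v ∧ Solid G u v := by
  by_contra! hN
  obtain ⟨x, hx, -⟩ := hG.exists_ne r r r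
  obtain ⟨u, hux⟩ := hD.exists_covBy hx
  have := hN u x hux
  unfold Solid at this
  push Not at this
  obtain ⟨A, T, B, hS, hT, hu, hx, -⟩ := this
  -- Every left side contains an end, and only the root is left as an end. This applies to both
  -- sides.
  have key : ∀ {A B : Finset V}, Separation G A T B → r ∈ A := by
    intro A B hS
    obtain ⟨y, hy, T₀, hT₀, hNy, hcov⟩ := hD.exists_end hG hN hS hT ⟨u, hu, x, hx, hux⟩
    rcases hD.end_eq_root_or_leaf hG hN hT₀ hNy hcov with rfl | h
    · exact hy
    · obtain ⟨a, b, c, hmax, hba, hax, hcb, hNy⟩ := h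
      obtain ⟨w, B', T', C', hS', hTc', hT', -, -, hb', hc'⟩ :=
        exists_separation_of_not_solid hG (fun h => hN a y hax h.symm) hNy
      exact (hD.not_leaf_end hG hN B' hS' hTc' hmax hba hax hcb hNy hT' hb' hc').elim
  exact hS.not_mem_right r (key hS) (key hS.symm)

end Ends

/-! ### Contraction of a solid edge. -/

/-- The contraction of the edge `pq`, with `p` representing the new vertex. -/
def edgeContract {V : Type*} (G : SimpleGraph V) (p q : V) : SimpleGraph {v : V // v ≠ q} where
  Adj u v := u ≠ v ∧ (G.Adj u v ∨ (u.1 = p ∧ G.Adj q v) ∨ (v.1 = p ∧ G.Adj q u))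
  symm := ⟨fun u v h => ⟨h.1.symm, by
    rcases h.2 with h | h | h
    · exact Or.inl h.symm
    · exact Or.inr (Or.inr h)
    · exact Or.inr (Or.inl h)⟩⟩
  loopless := ⟨fun _ h => h.1 rfl⟩

/-- Every separation of order three with `u` and `v` in its middle part cuts off just one of the
vertices `p` and `q`. -/
def Fragile {V : Type*} (G : SimpleGraph V) (p q u v : V) : Prop :=
  ∀ A T B, Separation G A T B → T.card = 3 → u ∈ T → v ∈ T →
    A = {p} ∨ A = {q} ∨ B = {p} ∨ B = {q}

section Contract

set_option linter.unusedSectionVars false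

variable {V : Type*} [Finite V] {G : SimpleGraph V} {p q : V}

theorem edgeContract_adj_of_adj {u v : {v : V // v ≠ q}} (h : G.Adj u v) :
    (edgeContract G p q).Adj u v :=
  ⟨fun h' => h.ne (congrArg Subtype.val h'), Or.inl h⟩

theorem edgeContract_adj_of_adj_right {u v : {v : V // v ≠ q}} (hu : u.1 = p) (hv : v.1 ≠ p)
    (h : G.Adj q v) : (edgeContract G p q).Adj u v :=
  ⟨fun h' => hv (h' ▸ hu), Or.inr (Or.inl ⟨hu, h⟩)⟩

theorem Separation.lift_left [DecidableEq V] {A T B : Finset {v : V // v ≠ q}}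
    (hS : Separation (edgeContract G p q) A T B) {p' : {v : V // v ≠ q}} (hp' : p'.1 = p)
    (hp : p' ∈ A) :
    Separation G (insert q (A.map (Function.Embedding.subtype _)))
      (T.map (Function.Embedding.subtype _)) (B.map (Function.Embedding.subtype _)) := by
  have hmid := hS.not_mem_mid
  have hright := hS.not_mem_right
  have hmid' := hS.right_not_mem_mid
  constructor
  · exact Finset.insert_nonempty _ _
  · exact hS.right.map
  · intro v
    by_cases hv : v = q
    · exact Or.inl (by simp [hv])
    · have := hS.cover ⟨v, hv⟩
      simpa [hv] using this
  · intro v hv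
    by_cases hvq : v = q
    · simp [hvq]
    · have := hmid ⟨v, hvq⟩
      simp [hvq] at hv ⊢
      exact this hv
  · intro v hv
    by_cases hvq : v = q
    · simp [hvq]
    · have := hright ⟨v, hvq⟩
      simp [hvq] at hv ⊢
      exact this hv
  · intro v hv
    by_cases hvq : v = q
    · simp [hvq] at hv
    · have := hmid' ⟨v, hvq⟩
      simp [hvq] at hv ⊢
      exact this hv
  · intro u hu v hv huv
    have hvq : v ≠ q := by
      rintro rfl
      simp at hv
    have hvB : ⟨v, hvq⟩ ∈ B := by simpa [hvq] using hv
    by_cases huq : u = q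
    · refine hS.not_adj p' hp ⟨v, hvq⟩ hvB (edgeContract_adj_of_adj_right hp' ?_ (huq ▸ huv))
      rintro rfl
      exact hright p' hp (by convert hvB)
    · have huA : ⟨u, huq⟩ ∈ A := by simpa [huq] using hu
      exact hS.not_adj _ huA _ hvB (edgeContract_adj_of_adj huv)

theorem Separation.lift_mid [DecidableEq V] {A T B : Finset {v : V // v ≠ q}}
    (hS : Separation (edgeContract G p q) A T B) :
    Separation G (A.map (Function.Embedding.subtype _))
      (insert q (T.map (Function.Embedding.subtype _)))
      (B.map (Function.Embedding.subtype _)) := by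
  have hmid := hS.not_mem_mid
  have hright := hS.not_mem_right
  have hmid' := hS.right_not_mem_mid
  constructor
  · exact hS.left.map
  · exact hS.right.map
  · intro v
    by_cases hv : v = q
    · exact Or.inr (Or.inl (by simp [hv]))
    · have := hS.cover ⟨v, hv⟩
      simpa [hv] using this
  · intro v hv
    by_cases hvq : v = q
    · simp [hvq] at hv
    · have := hmid ⟨v, hvq⟩
      simp [hvq] at hv ⊢
      exact this hv
  · intro v hv
    by_cases hvq : v = q
    · simp [hvq]
    · have := hright ⟨v, hvq⟩
      simp [hvq] at hv ⊢
      exact this hv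
  · intro v hv
    by_cases hvq : v = q
    · simp [hvq] at hv
    · have := hmid' ⟨v, hvq⟩
      simp [hvq] at hv ⊢
      exact this hv
  · intro u hu v hv huv
    have hvq : v ≠ q := by
      rintro rfl
      simp at hv
    have huq : u ≠ q := by
      rintro rfl
      simp at hu
    have hvB : ⟨v, hvq⟩ ∈ B := by simpa [hvq] using hv
    have huA : ⟨u, huq⟩ ∈ A := by simpa [huq] using hu
    exact hS.not_adj _ huA _ hvB (edgeContract_adj_of_adj huv)

theorem card_ne_add_one (q : V) : Nat.card {v : V // v ≠ q} + 1 = Nat.card V := by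
  classical
  have := Fintype.ofFinite V
  have h0 : 0 < Fintype.card V := Fintype.card_pos_iff.2 ⟨q⟩
  rw [Nat.card_eq_fintype_card, Nat.card_eq_fintype_card, Fintype.card_subtype_compl,
    Fintype.card_subtype_eq]
  omega

/-- A separation with the new vertex on a side lifts with the same order. With the new vertex in the
middle the order grows by one, so order two would lift to a separation of order three through `p`
and `q`. -/
theorem ThreeConnected.of_edgeContract (hG : ThreeConnected G) (h5 : 5 ≤ Nat.card V)
    (hpq : p ≠ q) (hs : Solid G p q) : ThreeConnected (edgeContract G p q) := by
  classical
  constructor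
  · have := card_ne_add_one q
    omega
  · intro A T B hS
    rcases hS.cover ⟨p, hpq⟩ with h | h | h
    · simpa using hG.three_le _ _ _ (hS.lift_left rfl h)
    · have h3 := hG.three_le _ _ _ hS.lift_mid
      have hcard : (insert q (T.map (Function.Embedding.subtype _))).card = T.card + 1 := by
        rw [Finset.card_insert_of_notMem (by simp), Finset.card_map]
      by_contra hlt
      refine hs _ _ _ hS.lift_mid (by omega) ?_ (Finset.mem_insert_self _ _)
      simp [hpq, h]
    · simpa using hG.three_le _ _ _ (hS.symm.lift_left rfl h)

theorem Separation.push_left {A T B : Finset V} (hS : Separation G A T B) (hpq : G.Adj p q)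
    (hq : q ∈ A) (hA : A ≠ {q}) [DecidableEq V] :
    Separation (Foxes.edgeContract G p q) (A.subtype (· ≠ q)) (T.subtype (· ≠ q))
      (B.subtype (· ≠ q)) := by
  have hpB : p ∉ B := fun h => hS.not_adj q hq p h hpq.symm
  constructor
  · obtain ⟨a, ha, haq⟩ : ∃ a ∈ A, a ≠ q := by
      by_contra! h
      exact hA (Finset.eq_singleton_iff_unique_mem.2 ⟨hq, h⟩)
    exact ⟨⟨a, haq⟩, by simpa using ha⟩
  · obtain ⟨b, hb⟩ := hS.right
    exact ⟨⟨b, fun h => hS.not_mem_right q hq (h ▸ hb)⟩, by simpa using hb⟩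
  · intro v
    simpa using hS.cover v
  · intro v
    simpa using hS.not_mem_mid v
  · intro v
    simpa using hS.not_mem_right v
  · intro v
    simpa using hS.right_not_mem_mid v
  · rintro u hu v hv ⟨-, h | h | h⟩
    · exact hS.not_adj u (by simpa using hu) v (by simpa using hv) h
    · exact hS.not_adj q hq v (by simpa using hv) h.2
    · exact hpB (h.1 ▸ by simpa using hv)

theorem Separation.push_mid {A T B : Finset V} (hS : Separation G A T B) {p' : {v : V // v ≠ q}}
    (hp' : p'.1 = p) (hp : p ∈ A) (hq : q ∈ T) (hA : A ≠ {p}) [DecidableEq V] :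
    Separation (Foxes.edgeContract G p q) ((A.erase p).subtype (· ≠ q))
      (insert p' (T.subtype (· ≠ q))) (B.subtype (· ≠ q)) := by
  have hpB : p ∉ B := fun h => hS.not_mem_right p hp h
  have hval : ∀ v : {v : V // v ≠ q}, v = p' ↔ v.1 = p := fun v => by
    rw [← hp', Subtype.ext_iff]
  constructor
  · obtain ⟨a, ha, hap⟩ : ∃ a ∈ A, a ≠ p := by
      by_contra! h
      exact hA (Finset.eq_singleton_iff_unique_mem.2 ⟨hp, h⟩)
    exact ⟨⟨a, fun h => hS.not_mem_mid a ha (h ▸ hq)⟩, by simpa using ⟨hap, ha⟩⟩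
  · obtain ⟨b, hb⟩ := hS.right
    exact ⟨⟨b, fun h => hS.right_not_mem_mid b hb (h ▸ hq)⟩, by simpa using hb⟩
  · intro v
    have := hS.cover v
    simp only [Finset.mem_subtype, Finset.mem_erase, Finset.mem_insert, hval]
    tauto
  · intro v
    have := hS.not_mem_mid v
    simp only [Finset.mem_subtype, Finset.mem_erase, Finset.mem_insert, hval]
    tauto
  · intro v
    have := hS.not_mem_right v
    simp only [Finset.mem_subtype, Finset.mem_erase]
    tauto
  · intro v hv
    have h1 := hS.right_not_mem_mid v
    simp only [Finset.mem_subtype, Finset.mem_insert, hval] at hv ⊢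
    rintro (h | h)
    · exact hpB (h ▸ hv)
    · exact h1 hv h
  · rintro u hu v hv ⟨-, h | h | h⟩
    · simp only [Finset.mem_subtype, Finset.mem_erase] at hu hv
      exact hS.not_adj u hu.2 v hv h
    · simp only [Finset.mem_subtype, Finset.mem_erase] at hu
      exact hu.1 h.1
    · exact hpB (h.1 ▸ by simpa using hv)

/-- As `pq` is solid, a separation of order three has `p` or `q` on a side. It descends to the
contraction with the same order unless that side is a single vertex. The lift `u'` of `u` may be `q`
if `u` is the contracted vertex. -/
theorem fragile_of_solid_edgeContract (hpq : G.Adj p q) (hs : Solid G p q)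
    {u v : {v : V // v ≠ q}} (huv : Solid (edgeContract G p q) u v) {u' : V}
    (hu' : u' = u ∨ (u' = q ∧ u.1 = p)) : Fragile G p q u' v := by
  classical
  have aux : ∀ A T B, Separation G A T B → T.card = 3 → u' ∈ T → v.1 ∈ T →
      (p ∈ A ∨ q ∈ A) → A = {p} ∨ A = {q} := by
    intro A T B hS hT hu hv hpqA
    by_contra! hcon
    by_cases hq : q ∈ A
    · have hqT := hS.not_mem_mid q hq
      have huu : u' = u := by
        rcases hu' with h | h
        · exact h
        · exact (hqT (h.1 ▸ hu)).elim
      refine huv _ _ _ (hS.push_left hpq hq hcon.2) ?_ (by simpa using huu ▸ hu) (by simpa using hv)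
      rw [Finset.card_subtype, Finset.filter_true_of_mem, hT]
      rintro x hx rfl
      exact hqT hx
    · have hp : p ∈ A := hpqA.resolve_right hq
      have hqT : q ∈ T := (hS.mem_or_mem hp hpq).resolve_left hq
      refine huv _ _ _ (hS.push_mid (p' := ⟨p, hpq.ne⟩) rfl hp hqT hcon.1) ?_ ?_ ?_
      · rw [Finset.card_insert_of_notMem, Finset.card_subtype, Finset.filter_ne',
          Finset.card_erase_of_mem hqT, hT]
        simpa using hS.not_mem_mid p hp
      · rw [Finset.mem_insert, Finset.mem_subtype]
        rcases hu' with h | h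
        · exact Or.inr (h ▸ hu)
        · exact Or.inl (Subtype.ext h.2)
      · rw [Finset.mem_insert, Finset.mem_subtype]
        exact Or.inr hv
  intro A T B hS hT hu hv
  by_cases hA : p ∈ A ∨ q ∈ A
  · have := aux A T B hS hT hu hv hA
    tauto
  by_cases hB : p ∈ B ∨ q ∈ B
  · have := aux B T A hS.symm hT hu hv hB
    tauto
  · have h1 := hS.cover p
    have h2 := hS.cover q
    exact (hs A T B hS hT (by tauto) (by tauto)).elim

theorem Fragile.exists_adj_iff {u v : V} (hG : ThreeConnected G) (hf : Fragile G p q u v)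
    (huv : ¬ Solid G u v) :
    ∃ T : Finset V, T.card = 3 ∧ u ∈ T ∧ v ∈ T ∧
      ((∀ w, G.Adj p w ↔ w ∈ T) ∨ ∀ w, G.Adj q w ↔ w ∈ T) := by
  unfold Solid at huv
  push Not at huv
  obtain ⟨A, T, B, hS, hT, hu, hv, -⟩ := huv
  refine ⟨T, hT, hu, hv, ?_⟩
  rcases hf A T B hS hT hu hv with rfl | rfl | rfl | rfl
  · exact Or.inl (hS.adj_iff_of_singleton hG hT)
  · exact Or.inr (hS.adj_iff_of_singleton hG hT)
  · exact Or.inl (hS.symm.adj_iff_of_singleton hG hT)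
  · exact Or.inr (hS.symm.adj_iff_of_singleton hG hT)

variable [PartialOrder V] {r : V}

/-- Only the parent end can change, when a child of `q` becomes a child of the contracted vertex.
Tree edges can thus be told apart by their child ends before and after the contraction. -/
theorem DFSOrder.covBy_lift (hD : DFSOrder G r) (hpq : p ⋖ q) {u v : {v : V // v ≠ q}}
    (huv : u ⋖ v) : ∃ u' : V, u' ⋖ v ∧ (u' = u ∨ (u' = q ∧ u.1 = p)) := by
  have hlt : u.1 < v.1 := huv.lt
  obtain ⟨u', huu', hu'v⟩ := exists_le_covBy_of_lt hlt
  refine ⟨u', hu'v, ?_⟩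
  by_cases hu'q : u' = q
  · right
    refine ⟨hu'q, ?_⟩
    have huq : u.1 < q := lt_of_le_of_ne (hu'q ▸ huu') u.2
    have hqv : q < v.1 := by
      have := hu'v.lt
      rwa [hu'q] at this
    have h1 := hD.le_of_lt_of_covBy huq hpq
    by_contra hne
    have h2 : u.1 < p := lt_of_le_of_ne h1 hne
    have h3 : p < v.1 := hpq.lt.trans hqv
    exact huv.2 (c := ⟨p, hpq.ne⟩) h2 h3
  · left
    by_contra hne
    have h2 : u.1 < u' := lt_of_le_of_ne huu' (Ne.symm hne)
    exact huv.2 (c := ⟨u', hu'q⟩) h2 hu'v.lt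

theorem DFSOrder.of_edgeContract (hD : DFSOrder G r) (hpq : p ⋖ q) (hr : r ≠ q) :
    DFSOrder (edgeContract G p q) ⟨r, hr⟩ where
  root_le v := hD.root_le v
  chain h1 h2 := hD.chain (w := (_ : {v : V // v ≠ q}).1) h1 h2
  adj_of_covBy {u v} huv := by
    obtain ⟨u', hu'v, h | h⟩ := hD.covBy_lift hpq huv
    · exact edgeContract_adj_of_adj (h ▸ hD.adj_of_covBy hu'v)
    · have hadj := hD.adj_of_covBy hu'v
      rw [h.1] at hadj
      refine edgeContract_adj_of_adj_right h.2 ?_ hadj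
      rw [← h.2]
      exact fun h' => huv.ne (Subtype.ext h'.symm)
  comparable {u v} huv := by
    have key : ∀ u v : {v : V // v ≠ q}, u.1 = p → G.Adj q v → u ≤ v ∨ v ≤ u := by
      intro u v hu hv
      rcases hD.comparable hv with h | h
      · exact Or.inl (show u.1 ≤ v.1 from hu ▸ hpq.le.trans h)
      · exact Or.inr (show v.1 ≤ u.1 from hu ▸ hD.le_of_lt_of_covBy (lt_of_le_of_ne h v.2) hpq)
    rcases huv.2 with h | h | h
    · exact hD.comparable h
    · exact key u v h.1 h.2
    · exact (key v u h.1 h.2).symm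

end Contract

/-! ### The induction claim, and tree edges in neighbourhoods of `p` and `q`. -/

/-- There are two solid tree edges that do not form a path of length two along a branch with ends
adjacent in `G`. -/
def HasTwoSolid {V : Type*} [PartialOrder V] (G : SimpleGraph V) : Prop :=
  ∃ u₁ v₁ u₂ v₂ : V, u₁ ⋖ v₁ ∧ u₂ ⋖ v₂ ∧ Solid G u₁ v₁ ∧ Solid G u₂ v₂ ∧ v₁ ≠ v₂ ∧
    ¬ (v₁ = u₂ ∧ G.Adj u₁ v₂) ∧ ¬ (v₂ = u₁ ∧ G.Adj u₂ v₁)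

/-- The tree is the path `abpqcd`, and the graph is that of a prism with triangles `abp`, `cdq`,
possibly with one more edge. -/
structure PrismOrder {V : Type*} [PartialOrder V] (G : SimpleGraph V) (a b p q c d : V) :
    Prop where
  ab : a ⋖ b
  bp : b ⋖ p
  pq : p ⋖ q
  qc : q ⋖ c
  cd : c ⋖ d
  cover : ∀ v, v = a ∨ v = b ∨ v = p ∨ v = q ∨ v = c ∨ v = d
  adj_a : ∃ w, ∀ v, G.Adj a v ↔ v = p ∨ v = b ∨ v = w
  adj_p : ∀ v, G.Adj p v ↔ v = b ∨ v = a ∨ v = q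
  adj_q : ∀ v, G.Adj q v ↔ v = c ∨ v = d ∨ v = p
  adj_d : ∃ w, ∀ v, G.Adj d v ↔ v = q ∨ v = c ∨ v = w
  solid : Solid G p q

section Classify

set_option linter.unusedSectionVars false

variable {V : Type*} [PartialOrder V] [Finite V] {G : SimpleGraph V} {r p q u v : V}
  {T : Finset V}

theorem PrismOrder.not_adj {a b c d x : V} (h : PrismOrder G a b p q c d) (hp : G.Adj p x)
    (hq : G.Adj q x) : False := by
  have h1 := h.ab.lt
  have h2 := h.bp.lt
  have h3 := h.pq.lt
  have h4 := h.qc.lt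
  have h5 := h.cd.lt
  rcases (h.adj_p x).1 hp with rfl | rfl | rfl
  · rcases (h.adj_q _).1 hq with rfl | rfl | rfl
    · exact (h2.trans (h3.trans h4)).ne rfl
    · exact (h2.trans (h3.trans (h4.trans h5))).ne rfl
    · exact h2.ne rfl
  · rcases (h.adj_q _).1 hq with rfl | rfl | rfl
    · exact (h1.trans (h2.trans (h3.trans h4))).ne rfl
    · exact (h1.trans (h2.trans (h3.trans (h4.trans h5)))).ne rfl
    · exact (h1.trans h2).ne rfl
  · exact G.irrefl hq

/-- The neighbours of `q` when the tree edges inside its neighbourhood of size three are not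
solid. -/
theorem DFSOrder.lower_end (hG : ThreeConnected G) (hD : DFSOrder G r) (hpq : p ⋖ q)
    (hN : ∀ u v : V, u ⋖ v → v ≠ q → ¬ Solid G u v) (hT : T.card = 3)
    (hq : ∀ w, G.Adj q w ↔ w ∈ T) (huv : u ⋖ v) (hu : u ∈ T) (hv : v ∈ T) :
    (∀ x, q ≤ x → x = q) ∨ (q ⋖ u ∧ ∀ w, G.Adj q w ↔ w = u ∨ w = v ∨ w = p) := by
  by_cases hmax : ∀ x, q ≤ x → x = q
  · exact Or.inl hmax
  right
  push Not at hmax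
  obtain ⟨x, hqx, hne⟩ := hmax
  obtain ⟨a, hqa, -⟩ := exists_covBy_le_of_lt (lt_of_le_of_ne hqx (Ne.symm hne))
  have hpT : p ∈ T := (hq p).1 (hD.adj_of_covBy hpq).symm
  have haT : a ∈ T := (hq a).1 (hD.adj_of_covBy hqa)
  have hqT : q ∉ T := fun h => G.irrefl ((hq q).2 h)
  have hpa : p < a := hpq.lt.trans hqa.lt
  obtain ⟨c, hca, hcp, hc⟩ := exists_third hT haT hpT hpa.ne'
  -- The nonsolid edge `qa` separates `p` from `c`, and `q` lies between `p` and `a`, so only `a`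
  -- and `c` can form the tree edge in `T`.
  have hpc : ¬ G.Adj p c := not_adj_of_not_solid hG (hN q a hqa hqa.lt.ne')
    fun w => (hq w).trans (hc w)
  have huva := hD.adj_of_covBy huv
  rcases (hc u).1 hu with rfl | rfl | rfl
  · rcases (hc v).1 hv with rfl | rfl | rfl
    · exact (huv.ne rfl).elim
    · exact (hpa.asymm huv.lt).elim
    · exact ⟨hqa, fun w => by rw [hq, hc]; tauto⟩
  · rcases (hc v).1 hv with rfl | rfl | rfl
    · exact (huv.2 hpq.lt hqa.lt).elim
    · exact (huv.ne rfl).elim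
    · exact (hpc huva).elim
  · rcases (hc v).1 hv with rfl | rfl | rfl
    · exact (hqT (hD.eq_of_covBy huv hqa ▸ hu)).elim
    · exact (hpc huva.symm).elim
    · exact (huv.ne rfl).elim

theorem DFSOrder.upper_end (hG : ThreeConnected G) (hD : DFSOrder G r) (hpq : p ⋖ q)
    (hN : ∀ u v : V, u ⋖ v → v ≠ q → ¬ Solid G u v) (hT : T.card = 3)
    (hp : ∀ w, G.Adj p w ↔ w ∈ T) (huv : u ⋖ v) (hu : u ∈ T) (hv : v ∈ T) :
    p = r ∨ (v ⋖ p ∧ ∀ w, G.Adj p w ↔ w = v ∨ w = u ∨ w = q) := by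
  by_cases hpr : p = r
  · exact Or.inl hpr
  right
  obtain ⟨a, hap⟩ := hD.exists_covBy hpr
  have hqT : q ∈ T := (hp q).1 (hD.adj_of_covBy hpq)
  have haT : a ∈ T := (hp a).1 (hD.adj_of_covBy hap).symm
  have hpT : p ∉ T := fun h => G.irrefl ((hp p).2 h)
  have haq : a < q := hap.lt.trans hpq.lt
  obtain ⟨c, hca, hcq, hc⟩ := exists_third hT haT hqT haq.ne
  have hqc : ¬ G.Adj q c := not_adj_of_not_solid hG
    (fun h => hN a p hap hpq.lt.ne h.symm) fun w => (hp w).trans (hc w)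
  have huva := hD.adj_of_covBy huv
  rcases (hc u).1 hu with rfl | rfl | rfl
  · rcases (hc v).1 hv with rfl | rfl | rfl
    · exact (huv.ne rfl).elim
    · exact (huv.2 hap.lt hpq.lt).elim
    · exfalso
      have hvp : v ≠ p := fun h => hpT (h ▸ hv)
      rcases hD.comparable ((hp v).2 hv) with h | h
      · exact huv.2 hap.lt (lt_of_le_of_ne h hvp.symm)
      · exact huv.lt.not_ge (hD.le_of_lt_of_covBy (lt_of_le_of_ne h hvp) hap)
  · rcases (hc v).1 hv with rfl | rfl | rfl
    · exact (haq.asymm huv.lt).elim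
    · exact (huv.ne rfl).elim
    · exact (hqc huva).elim
  · rcases (hc v).1 hv with rfl | rfl | rfl
    · exact ⟨hap, fun w => by rw [hp, hc]; tauto⟩
    · exact (hqc huva.symm).elim
    · exact (huv.ne rfl).elim

/-- If `x` has neighbours `a`, `b`, `y`, where `xa` is not solid and `ab` is fragile with respect to
`x` and `y`, then `b` has degree three, and `ba` is the only tree edge at `b`. -/
theorem exists_adj_iff_of_fragile (hG : ThreeConnected G) {x y a b : V}
    (hN : ∀ v, G.Adj x v ↔ v = a ∨ v = b ∨ v = y) (hxa : ¬ Solid G x a)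
    (hf : ∀ A T B, Separation G A T B → T.card = 3 → a ∈ T → b ∈ T →
      A = {x} ∨ A = {y} ∨ B = {x} ∨ B = {y}) :
    ∃ w, (∀ v, G.Adj b v ↔ v = x ∨ v = a ∨ v = w) ∧
      ∀ c, G.Adj b c → ¬ Solid G b c → c = x ∨ c = a := by
  classical
  obtain ⟨w, A, T, B, hS, hTc, hT, hwx, hwa, hb, hy⟩ := exists_separation_of_not_solid hG hxa hN
  have hxa' : G.Adj x a := (hN a).2 (by simp)
  have hxy' : G.Adj x y := (hN y).2 (by simp)
  have haT : a ∈ T := (hT a).2 (by simp)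
  have hwT : w ∈ T := (hT w).2 (by simp)
  have hxT : x ∈ T := (hT x).2 (by simp)
  -- Otherwise exchanging `x` for `b` gives a separation through `a` and `b` that isolates neither
  -- `x` nor `y`.
  have hA : A = {b} := by
    by_contra hA
    have hAb : ∃ z ∈ A, z ≠ b := by
      by_contra! h
      exact hA (Finset.eq_singleton_iff_unique_mem.2 ⟨hb, h⟩)
    have hS' := hS.shift hxa'.ne hwx.symm hN hT hb hy hAb
    have hcard : ({b, a, w} : Finset V).card = 3 := by
      rw [Finset.card_eq_three]
      exact ⟨b, a, w, fun h => hS.not_mem_mid b hb (h ▸ haT),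
        fun h => hS.not_mem_mid b hb (h ▸ hwT), hwa.symm, rfl⟩
    rcases hf _ _ _ hS' hcard (by simp) (by simp) with h | h | h | h
    · have : x ∈ A.erase b := by rw [h]; simp
      exact hS.not_mem_mid x (Finset.mem_of_mem_erase this) hxT
    · have : y ∈ A.erase b := by rw [h]; simp
      exact hS.not_mem_right y (Finset.mem_of_mem_erase this) hy
    · have : y ∈ insert x B := Finset.mem_insert_of_mem hy
      rw [h, Finset.mem_singleton] at this
      exact hxy'.ne this.symm
    · have : x ∈ insert x B := Finset.mem_insert_self _ _
      rw [h, Finset.mem_singleton] at this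
      exact hxy'.ne this
  subst hA
  have hNb : ∀ v, G.Adj b v ↔ v = x ∨ v = a ∨ v = w := fun v =>
    (hS.adj_iff_of_singleton hG hTc v).trans (hT v)
  refine ⟨w, hNb, fun c hbc hs => ?_⟩
  rcases (hNb c).1 hbc with h | h | rfl
  · exact Or.inl h
  · exact Or.inr h
  · exact (not_adj_of_not_solid (b := x) (c := a) hG hs (fun v => by rw [hNb]; tauto) hxa').elim

/-- The subtree at `v₁` has no neighbours outside except `r` and `x`. -/
theorem DFSOrder.not_siblings (hG : ThreeConnected G) (hD : DFSOrder G r) {x v₁ v₂ : V}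
    (hx : r ⋖ x) (h1 : x ⋖ v₁) (h2 : x ⋖ v₂) (hne : v₁ ≠ v₂) : False := by
  refine hG.not_two_cut {y | v₁ ≤ y} r x ?_ ⟨v₁, le_rfl, (hx.lt.trans h1.lt).ne', h1.ne'⟩
    ⟨v₂, ?_, (hx.lt.trans h2.lt).ne', h2.ne'⟩
  · intro y hy _ _ z hyz
    rcases hD.comparable hyz with h | h
    · exact Or.inl (le_trans hy h)
    · rcases hD.chain h hy with h' | h'
      · rcases h'.eq_or_lt with rfl | h'
        · exact Or.inl le_rfl
        · have := hD.le_of_lt_of_covBy h' h1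
          rcases this.eq_or_lt with rfl | h''
          · exact Or.inr (Or.inr rfl)
          · exact Or.inr (Or.inl (le_antisymm (hD.le_of_lt_of_covBy h'' hx) (hD.root_le z)))
      · exact Or.inl h'
  · intro (h : v₁ ≤ v₂)
    exact h2.2 h1.lt (lt_of_le_of_ne h hne)

/-- An edge beyond `q` would exhaust `T` together with `p`, leaving no room for a second one. So the
two edges form a path ending in `p`, and as its first vertex is adjacent to `q`, its ends become
adjacent when `pq` is contracted. -/
theorem DFSOrder.two_covBy_lower (hD : DFSOrder G r) (hpq : p ⋖ q) (hT : T.card = 3)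
    (hq : ∀ w, G.Adj q w ↔ w ∈ T) {u₁ v₁ u₂ v₂ : V} (h1 : u₁ ⋖ v₁) (h2 : u₂ ⋖ v₂)
    (hne : v₁ ≠ v₂) (hu₁ : u₁ ∈ T) (hv₁ : v₁ ∈ T) (hu₂ : u₂ ∈ T) (hv₂ : v₂ ∈ T) :
    (v₁ = u₂ ∧ v₂ = p) ∨ (v₂ = u₁ ∧ v₁ = p) := by
  have hpT : p ∈ T := (hq p).1 (hD.adj_of_covBy hpq).symm
  have hqT : q ∉ T := fun h => G.irrefl ((hq q).2 h)
  have below : ∀ {u₁ v₁ u₂ v₂ : V}, u₁ ⋖ v₁ → u₂ ⋖ v₂ → v₁ ≠ v₂ → u₁ ∈ T → v₁ ∈ T → u₂ ∈ T →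
      v₂ ∈ T → v₁ ≤ p := by
    intro u₁ v₁ u₂ v₂ h1 h2 hne hu₁ hv₁ hu₂ hv₂
    have hvq : v₁ ≠ q := fun h => hqT (h ▸ hv₁)
    have huq : u₁ ≠ q := fun h => hqT (h ▸ hu₁)
    rcases hD.comparable ((hq v₁).2 hv₁) with h | h
    · exfalso
      have hqu : q < u₁ := lt_of_le_of_ne
        (hD.le_of_lt_of_covBy (lt_of_le_of_ne h hvq.symm) h1) huq.symm
      obtain ⟨c, hcp, hcv, hc⟩ := exists_third hT hpT hv₁ (hpq.lt.trans (hqu.trans h1.lt)).ne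
      have huc : u₁ = c := by
        rcases (hc u₁).1 hu₁ with h | h | h
        · exact ((hpq.lt.trans hqu).ne' h).elim
        · exact (h1.ne h).elim
        · exact h
      subst huc
      rcases (hc v₂).1 hv₂ with rfl | rfl | rfl
      · rcases (hc u₂).1 hu₂ with rfl | rfl | rfl
        · exact h2.ne rfl
        · exact (hpq.lt.trans (hqu.trans h1.lt)).asymm h2.lt
        · exact (hpq.lt.trans hqu).asymm h2.lt
      · exact hne rfl
      · rcases (hc u₂).1 hu₂ with rfl | rfl | rfl
        · exact h2.2 hpq.lt hqu
        · exact h1.lt.asymm h2.lt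
        · exact h2.ne rfl
    · exact hD.le_of_lt_of_covBy (lt_of_le_of_ne h hvq) hpq
  have hv₁p := below h1 h2 hne hu₁ hv₁ hu₂ hv₂
  have hv₂p := below h2 h1 hne.symm hu₂ hv₂ hu₁ hv₁
  have hu₁p := h1.lt.trans_le hv₁p
  have hu₂p := h2.lt.trans_le hv₂p
  by_cases hv₁' : v₁ = p
  · right
    refine ⟨?_, hv₁'⟩
    obtain ⟨c, hcp, hcv, hc⟩ := exists_third hT hpT hv₂ (hv₁' ▸ hne)
    have huc : u₂ = c := by
      rcases (hc u₂).1 hu₂ with h | h | h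
      · exact (hu₂p.ne h).elim
      · exact (h2.ne h).elim
      · exact h
    rcases (hc u₁).1 hu₁ with h | h | h
    · exact (hu₁p.ne h).elim
    · exact h.symm
    · exfalso
      have hu : u₁ = u₂ := h.trans huc.symm
      exact h1.2 (hu ▸ h2.lt) (lt_of_le_of_ne (hv₁' ▸ hv₂p) hne.symm)
  · left
    obtain ⟨c, hcp, hcv, hc⟩ := exists_third hT hpT hv₁ (Ne.symm hv₁')
    have huc : u₁ = c := by
      rcases (hc u₁).1 hu₁ with h | h | h
      · exact (hu₁p.ne h).elim
      · exact (h1.ne h).elim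
      · exact h
    have hv₂' : v₂ = p := by
      rcases (hc v₂).1 hv₂ with h | h | h
      · exact h
      · exact (hne h.symm).elim
      · exfalso
        rcases (hc u₂).1 hu₂ with h' | h' | h'
        · exact hu₂p.ne h'
        · exact h1.lt.asymm (huc.trans h.symm ▸ h' ▸ h2.lt)
        · exact h2.ne (h'.trans h.symm)
    refine ⟨?_, hv₂'⟩
    rcases (hc u₂).1 hu₂ with h | h | h
    · exact (hu₂p.ne h).elim
    · exact h.symm
    · exfalso
      have hu : u₂ = u₁ := h.trans huc.symm
      exact h2.2 (hu ▸ h1.lt) (lt_of_le_of_ne (hv₂' ▸ hv₁p) hne)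

/-- The counterpart at `p`: the two edges form a path starting in `q`. If both started in `q`, then
`p` would be the root and `q` would have two children. -/
theorem DFSOrder.two_covBy_upper (hG : ThreeConnected G) (hD : DFSOrder G r) (hpq : p ⋖ q)
    (hT : T.card = 3) (hp : ∀ w, G.Adj p w ↔ w ∈ T) {u₁ v₁ u₂ v₂ : V} (h1 : u₁ ⋖ v₁)
    (h2 : u₂ ⋖ v₂) (hne : v₁ ≠ v₂) (hu₁ : u₁ ∈ T) (hv₁ : v₁ ∈ T) (hu₂ : u₂ ∈ T) (hv₂ : v₂ ∈ T) :
    (v₁ = u₂ ∧ u₁ = q) ∨ (v₂ = u₁ ∧ u₂ = q) := by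
  have hqT : q ∈ T := (hp q).1 (hD.adj_of_covBy hpq)
  have hpT : p ∉ T := fun h => G.irrefl ((hp p).2 h)
  have hvq : ∀ {u v : V}, u ⋖ v → u ∈ T → v ≠ q := by
    rintro u v huv hu rfl
    exact hpT (hD.eq_of_covBy hpq huv ▸ hu)
  have hv₁q := hvq h1 hu₁
  have hv₂q := hvq h2 hu₂
  obtain ⟨c, hcq, hcv, hc⟩ := exists_third hT hqT hv₁ hv₁q.symm
  have hv₂c : v₂ = c := by
    rcases (hc v₂).1 hv₂ with h | h | h
    · exact (hv₂q h).elim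
    · exact (hne h.symm).elim
    · exact h
  subst hv₂c
  rcases (hc u₁).1 hu₁ with rfl | h | rfl
  · rcases (hc u₂).1 hu₂ with rfl | h | h
    · exfalso
      have hpr : p = r := by
        by_contra hpr
        obtain ⟨a, ha⟩ := hD.exists_covBy hpr
        have haT := (hp a).1 (hD.adj_of_covBy ha).symm
        rcases (hc a).1 haT with rfl | rfl | rfl
        · exact hpq.lt.asymm ha.lt
        · exact (hpq.lt.trans h1.lt).asymm ha.lt
        · exact (hpq.lt.trans h2.lt).asymm ha.lt
      subst hpr
      exact hD.not_siblings hG hpq h1 h2 hne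
    · exact Or.inl ⟨h.symm, rfl⟩
    · exact (h2.ne h).elim
  · exact (h1.ne h).elim
  · rcases (hc u₂).1 hu₂ with h | rfl | h
    · exact Or.inr ⟨rfl, h⟩
    · exact (h1.lt.asymm h2.lt).elim
    · exact (h2.ne h).elim

end Classify

/-! ### Contracting the only solid tree edge. -/

section Unique

set_option linter.unusedSectionVars false

variable {V : Type*} [PartialOrder V] [Finite V] {G : SimpleGraph V} {r p q : V}

theorem DFSOrder.prismOrder_of_path (hG : ThreeConnected G) (hD : DFSOrder G r) {b c d w w' : V}
    (hrb : r ⋖ b) (hbp : b ⋖ p) (hpq : p ⋖ q) (hqc : q ⋖ c) (hcd : c ⋖ d) (hs : Solid G p q)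
    (hf : Fragile G p q r b)
    (hNr : ∀ v, G.Adj r v ↔ v = p ∨ v = b ∨ v = w)
    (hNp : ∀ v, G.Adj p v ↔ v = b ∨ v = r ∨ v = q)
    (hNq : ∀ v, G.Adj q v ↔ v = c ∨ v = d ∨ v = p)
    (hNd : ∀ v, G.Adj d v ↔ v = q ∨ v = c ∨ v = w') (hd : ∀ x, d ≤ x → x = d) :
    PrismOrder G r b p q c d := by
  classical
  have hw' : w' = b ∨ w' = r := by
    obtain ⟨y, hdy, hyq, hyc⟩ := hG.exists_adj_ne d q c
    have hyw : y = w' := by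
      rcases (hNd y).1 hdy with h | h | h
      · exact (hyq h).elim
      · exact (hyc h).elim
      · exact h
    have hyd : y < d := by
      rcases hD.comparable hdy with h | h
      · exact (hdy.ne (hd y h).symm).elim
      · exact lt_of_le_of_ne h hdy.ne'
    have h1 := hD.le_of_lt_of_covBy (lt_of_le_of_ne (hD.le_of_lt_of_covBy hyd hcd) hyc) hqc
    have h2 := hD.le_of_lt_of_covBy (lt_of_le_of_ne h1 hyq) hpq
    have hyp : y ≠ p := by
      rintro rfl
      rcases (hNp d).1 hdy.symm with rfl | rfl | rfl
      · exact (hbp.lt.trans (hpq.lt.trans (hqc.lt.trans hcd.lt))).ne rfl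
      · exact (hrb.lt.trans (hbp.lt.trans (hpq.lt.trans (hqc.lt.trans hcd.lt)))).ne rfl
      · exact (hqc.lt.trans hcd.lt).ne rfl
    have h3 := hD.le_of_lt_of_covBy (lt_of_le_of_ne h2 hyp) hbp
    rcases h3.eq_or_lt with h | h
    · exact Or.inl (hyw ▸ h)
    · exact Or.inr (hyw ▸ le_antisymm (hD.le_of_lt_of_covBy h hrb) (hD.root_le y))
  have hrp := hrb.lt.trans hbp.lt
  have hbq := hbp.lt.trans hpq.lt
  have hbc := hbq.trans hqc.lt
  have hbd := hbc.trans hcd.lt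
  have hrq := hrp.trans hpq.lt
  have hrc := hrb.lt.trans hbc
  have hrd := hrb.lt.trans hbd
  have hpc := hpq.lt.trans hqc.lt
  have hpd := hpc.trans hcd.lt
  have hqd := hqc.lt.trans hcd.lt
  refine ⟨hrb, hbp, hpq, hqc, hcd, ?_, ⟨w, hNr⟩, hNp, hNq, ⟨w', hNd⟩, hs⟩
  -- A further vertex would be separated from `{p, q, d}` by `{b, c, r}`, contrary to the fragility
  -- of the edge `rb`.
  by_contra! hcov
  obtain ⟨z, hz1, hz2, hz3, hz4, hz5, hz6⟩ := hcov
  have := Fintype.ofFinite V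
  have hS : Separation G
      (Finset.univ.filter fun v => v ≠ r ∧ v ≠ b ∧ v ≠ p ∧ v ≠ q ∧ v ≠ c ∧ v ≠ d) {b, c, r}
      {p, q, d} := by
    constructor
    · exact ⟨z, by simp [*]⟩
    · exact ⟨p, by simp⟩
    · intro v
      simp only [Finset.mem_filter, Finset.mem_univ, true_and, Finset.mem_insert,
        Finset.mem_singleton]
      tauto
    · intro v
      simp only [Finset.mem_filter, Finset.mem_univ, true_and, Finset.mem_insert,
        Finset.mem_singleton]
      tauto
    · intro v
      simp only [Finset.mem_filter, Finset.mem_univ, true_and, Finset.mem_insert,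
        Finset.mem_singleton]
      tauto
    · intro v hv
      simp only [Finset.mem_insert, Finset.mem_singleton] at hv ⊢
      rcases hv with rfl | rfl | rfl
      · simp [hbp.ne', hpc.ne, hrp.ne']
      · simp [hbq.ne', hqc.ne, hrq.ne']
      · simp [hbd.ne', hcd.ne', hrd.ne']
    · intro u hu v hv huv
      simp only [Finset.mem_filter, Finset.mem_univ, true_and] at hu
      simp only [Finset.mem_insert, Finset.mem_singleton] at hv
      rcases hv with rfl | rfl | rfl
      · have := (hNp u).1 huv.symm
        tauto
      · have := (hNq u).1 huv.symm
        tauto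
      · have := (hNd u).1 huv.symm
        rcases hw' with rfl | rfl <;> tauto
  have hcard : ({b, c, r} : Finset V).card = 3 := by
    rw [Finset.card_eq_three]
    exact ⟨b, c, r, hbc.ne, hrb.ne', hrc.ne', rfl⟩
  rcases hf _ _ _ hS hcard (by simp) (by simp) with h | h | h | h
  · have : p ∈ ({p} : Finset V) := Finset.mem_singleton_self p
    rw [← h] at this
    simp at this
  · have : q ∈ ({q} : Finset V) := Finset.mem_singleton_self q
    rw [← h] at this
    simp at this
  · have : q ∈ ({p, q, d} : Finset V) := by simp
    rw [h, Finset.mem_singleton] at this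
    exact hpq.ne' this
  · have : p ∈ ({p, q, d} : Finset V) := by simp
    rw [h, Finset.mem_singleton] at this
    exact hpq.ne this

/-- The case that one fragile tree edge lies in the neighbourhood of `p` and another one in that of
`q`. -/
theorem DFSOrder.prismOrder_of_fragile (hG : ThreeConnected G) (hD : DFSOrder G r)
    (h5 : 5 ≤ Nat.card V) (hpq : p ⋖ q) (hs : Solid G p q)
    (hN : ∀ u v : V, u ⋖ v → v ≠ q → ¬ Solid G u v) {T₁ T₂ : Finset V} (hT₁ : T₁.card = 3)
    (hT₂ : T₂.card = 3) (hp : ∀ w, G.Adj p w ↔ w ∈ T₁) (hq : ∀ w, G.Adj q w ↔ w ∈ T₂)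
    {u₁ v₁ u₂ v₂ : V} (h1 : u₁ ⋖ v₁) (h2 : u₂ ⋖ v₂) (hf₁ : Fragile G p q u₁ v₁)
    (hf₂ : Fragile G p q u₂ v₂) (hu₁ : u₁ ∈ T₁) (hv₁ : v₁ ∈ T₁) (hu₂ : u₂ ∈ T₂)
    (hv₂ : v₂ ∈ T₂) : ∃ a b c d, PrismOrder G a b p q c d := by
  have hqleaf : ∀ {y}, q ⋖ u₂ → (∀ w, G.Adj q w ↔ w = u₂ ∨ w = v₂ ∨ w = y) → y = p →
      ∃ w, (∀ v, G.Adj v₂ v ↔ v = q ∨ v = u₂ ∨ v = w) ∧ ∀ x, v₂ ≤ x → x = v₂ := by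
    rintro y hqu hNq rfl
    obtain ⟨w, hw, hleaf⟩ := exists_adj_iff_of_fragile hG hNq (hN q u₂ hqu hqu.lt.ne')
      (fun A T B hS hT ha hb => by
        have := hf₂ A T B hS hT ha hb
        tauto)
    refine ⟨w, hw, fun x hx => ?_⟩
    by_contra hne
    obtain ⟨z, hvz, -⟩ := exists_covBy_le_of_lt (lt_of_le_of_ne hx (Ne.symm hne))
    rcases hleaf z (hD.adj_of_covBy hvz)
      (hN v₂ z hvz (hqu.lt.trans (h2.lt.trans hvz.lt)).ne') with rfl | rfl
    · exact (hqu.lt.trans h2.lt).asymm hvz.lt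
    · exact h2.lt.asymm hvz.lt
  have hqmaxle : (∀ x, q ≤ x → x = q) → ∀ y, G.Adj q y → y ≤ p := by
    intro hqmax y hqy
    rcases hD.comparable hqy with h | h
    · exact (hqy.ne (hqmax y h).symm).elim
    · exact hD.le_of_lt_of_covBy (lt_of_le_of_ne h hqy.ne') hpq
  rcases hD.upper_end hG hpq hN hT₁ hp h1 hu₁ hv₁ with rfl | ⟨hvp, hNp⟩
  · exfalso
    rcases hD.lower_end hG hpq hN hT₂ hq h2 hu₂ hv₂ with hqmax | ⟨hqu, hNq⟩
    · obtain ⟨y, hqy, hyp, -⟩ := hG.exists_adj_ne q p p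
      exact hyp (le_antisymm (hqmaxle hqmax y hqy) (hD.root_le y))
    · obtain ⟨w, hNv, hmax⟩ := hqleaf hqu hNq rfl
      have hpv : G.Adj p v₂ := by
        obtain ⟨y, hvy, hyq, hyu⟩ := hG.exists_adj_ne v₂ q u₂
        rcases hD.comparable hvy with h | h
        · exact (hvy.ne (hmax y h).symm).elim
        · have h1 := hD.le_of_lt_of_covBy (lt_of_le_of_ne h hvy.ne') h2
          have h2 := hD.le_of_lt_of_covBy (lt_of_le_of_ne h1 hyu) hqu
          have h3 := hD.le_of_lt_of_covBy (lt_of_le_of_ne h2 hyq) hpq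
          exact (le_antisymm h3 (hD.root_le y) ▸ hvy).symm
      have hpT : p ∉ T₁ := fun h => G.irrefl ((hp p).2 h)
      have hqT : q ∈ T₁ := (hp q).1 (hD.adj_of_covBy hpq)
      have hvT : v₂ ∈ T₁ := (hp v₂).1 hpv
      have hqv : q < v₂ := hqu.lt.trans h2.lt
      obtain ⟨d, hdq, hdv, hd⟩ := exists_third hT₁ hqT hvT hqv.ne
      have hvu : ∀ {x}, v₂ ⋖ x → False := fun h => h.lt.ne' (hmax _ h.le)
      have hpx : ∀ {x}, x ⋖ q → x ∈ T₁ → False := fun h hx =>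
        hpT (hD.eq_of_covBy hpq h ▸ hx)
      have hdu : d = u₂ := by
        have hqd : q ⋖ d → d = u₂ := by
          intro h
          rcases (hNq d).1 (hD.adj_of_covBy h) with h' | h' | rfl
          · exact h'
          · exact (hdv h').elim
          · exact (h.lt.asymm hpq.lt).elim
        rcases (hd u₁).1 hu₁ with rfl | rfl | rfl
        · rcases (hd v₁).1 hv₁ with rfl | rfl | rfl
          · exact (h1.ne rfl).elim
          · exact (h1.2 hqu.lt h2.lt).elim
          · exact hqd h1
        · exact (hvu h1).elim
        · rcases (hd v₁).1 hv₁ with rfl | rfl | rfl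
          · exact (hpx h1 hu₁).elim
          · exact hD.eq_of_covBy h1 h2
          · exact (h1.ne rfl).elim
      subst hdu
      -- All neighbours of `p`, `q`, `v₂` outside this set coincide with `d`, so `d` is a cutvertex.
      obtain ⟨z, hzp, hzq, hzv, hzu⟩ := exists_ne_of_five_le h5 p q v₂ d
      refine hG.not_two_cut {x | x = p ∨ x = q ∨ x = v₂} d d ?_
        ⟨p, by simp, (hpq.lt.trans hqu.lt).ne, (hpq.lt.trans hqu.lt).ne⟩
        ⟨z, by simp [hzp, hzq, hzv], hzu, hzu⟩
      have hwp : ∀ y, G.Adj v₂ y → y = q ∨ y = d ∨ y = p := by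
        intro y hy
        rcases (hNv y).1 hy with h | h | h
        · exact Or.inl h
        · exact Or.inr (Or.inl h)
        · rcases (hNv p).1 hpv.symm with h' | h' | h'
          · exact (hpq.ne h').elim
          · exact ((hpq.lt.trans hqu.lt).ne h').elim
          · exact Or.inr (Or.inr (h.trans h'.symm))
      rintro x (rfl | rfl | rfl) - - y hxy
      · have := (hd y).1 ((hp y).1 hxy)
        simp only [Set.mem_ofPred_eq]
        tauto
      · have := (hNq y).1 hxy
        simp only [Set.mem_ofPred_eq]
        tauto
      · have := hwp y hxy
        simp only [Set.mem_ofPred_eq]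
        tauto
  · have hup : u₁ < p := h1.lt.trans hvp.lt
    obtain ⟨w, hNu, hleaf⟩ := exists_adj_iff_of_fragile hG hNp
      (fun h => hN v₁ p hvp hpq.ne h.symm) (fun A T B hS hT ha hb => hf₁ A T B hS hT hb ha)
    have hur : u₁ = r := by
      by_contra hne
      obtain ⟨z, hz⟩ := hD.exists_covBy hne
      rcases hleaf z (hD.adj_of_covBy hz).symm
        (fun h => hN z u₁ hz (hup.trans hpq.lt).ne h.symm) with rfl | rfl
      · exact hup.asymm hz.lt
      · exact h1.lt.asymm hz.lt
    subst hur
    rcases hD.lower_end hG hpq hN hT₂ hq h2 hu₂ hv₂ with hqmax | ⟨hqu, hNq⟩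
    -- The neighbours of the leaf `q` are among its ancestors `p`, `v₁`, `u₁`, so `{v₁, u₁}` cuts
    -- off `p` and `q`.
    · exfalso
      obtain ⟨z, hzp, hzq, hzv, hzu⟩ := exists_ne_of_five_le h5 p q v₁ u₁
      refine hG.not_two_cut {x | x = p ∨ x = q} v₁ u₁ ?_ ⟨p, by simp, hvp.ne', hup.ne'⟩
        ⟨z, by simp [hzp, hzq], hzv, hzu⟩
      rintro x (rfl | rfl) - - y hxy
      · have := (hNp y).1 hxy
        simp only [Set.mem_ofPred_eq]
        tauto
      · rcases (hqmaxle hqmax y hxy).eq_or_lt with h | h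
        · exact Or.inl (Or.inl h)
        · rcases (hD.le_of_lt_of_covBy h hvp).eq_or_lt with h | h
          · exact Or.inr (Or.inl h)
          · exact Or.inr (Or.inr (le_antisymm (hD.le_of_lt_of_covBy h h1) (hD.root_le y)))
    · obtain ⟨w', hNv, hmax⟩ := hqleaf hqu hNq rfl
      exact ⟨u₁, v₁, u₂, v₂, hD.prismOrder_of_path hG h1 hvp hpq hqu h2 hs hf₁ hNu hNp hNq hNv hmax⟩

/-- Both solid edges of the contraction lift to fragile nonsolid edges. If these lie in the same
neighbourhood, they violate the triangle clauses of `HasTwoSolid`; if one lies at `p` and one at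
`q`, the prism results. -/
theorem DFSOrder.prismOrder_of_contract (hG : ThreeConnected G) (hD : DFSOrder G r)
    (h5 : 5 ≤ Nat.card V) (hpq : p ⋖ q) (hs : Solid G p q)
    (hN : ∀ u v : V, u ⋖ v → v ≠ q → ¬ Solid G u v) (hH : HasTwoSolid (edgeContract G p q)) :
    ∃ a b c d, PrismOrder G a b p q c d := by
  obtain ⟨u₁, v₁, u₂, v₂, h1, h2, hs1, hs2, hne, ht1, ht2⟩ := hH
  have hpqa := hD.adj_of_covBy hpq
  obtain ⟨u₁', hc1, hl1⟩ := hD.covBy_lift hpq h1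
  obtain ⟨u₂', hc2, hl2⟩ := hD.covBy_lift hpq h2
  have hf1 := fragile_of_solid_edgeContract hpqa hs hs1 hl1
  have hf2 := fragile_of_solid_edgeContract hpqa hs hs2 hl2
  have hne' : v₁.1 ≠ v₂.1 := fun h => hne (Subtype.ext h)
  obtain ⟨T₁, hT₁, hu₁, hv₁, hN1⟩ := hf1.exists_adj_iff hG (hN _ _ hc1 v₁.2)
  obtain ⟨T₂, hT₂, hu₂, hv₂, hN2⟩ := hf2.exists_adj_iff hG (hN _ _ hc2 v₂.2)
  have heq : ∀ {T T' : Finset V} {x : V}, (∀ w, G.Adj x w ↔ w ∈ T) → (∀ w, G.Adj x w ↔ w ∈ T') →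
      T = T' := fun h h' => Finset.ext fun w => (h w).symm.trans (h' w)
  rcases hN1 with hN1 | hN1 <;> rcases hN2 with hN2 | hN2
  · exfalso
    obtain rfl := heq hN1 hN2
    have hne_p : ∀ {x}, x ∈ T₁ → x ≠ p := fun hx h => G.irrefl ((hN1 p).2 (h ▸ hx))
    rcases hD.two_covBy_upper hG hpq hT₁ hN1 hc1 hc2 hne' hu₁ hv₁ hu₂ hv₂ with ⟨h, h'⟩ | ⟨h, h'⟩
    · have hu1p : u₁.1 = p := by
        rcases hl1 with hl | hl
        · exact (u₁.2 (hl.symm.trans h')).elim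
        · exact hl.2
      have hv1u : v₁ = u₂ := by
        rcases hl2 with hl | hl
        · exact Subtype.ext (h.trans hl)
        · exact (v₁.2 (h.trans hl.1)).elim
      exact ht1 ⟨hv1u, edgeContract_adj_of_adj (by rw [hu1p, hN1]; exact hv₂)⟩
    · have hu2p : u₂.1 = p := by
        rcases hl2 with hl | hl
        · exact (u₂.2 (hl.symm.trans h')).elim
        · exact hl.2
      have hv2u : v₂ = u₁ := by
        rcases hl1 with hl | hl
        · exact Subtype.ext (h.trans hl)
        · exact (v₂.2 (h.trans hl.1)).elim
      exact ht2 ⟨hv2u, edgeContract_adj_of_adj (by rw [hu2p, hN1]; exact hv₁)⟩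
  · exact hD.prismOrder_of_fragile hG h5 hpq hs hN hT₁ hT₂ hN1 hN2 hc1 hc2 hf1 hf2 hu₁ hv₁ hu₂ hv₂
  · exact hD.prismOrder_of_fragile hG h5 hpq hs hN hT₂ hT₁ hN2 hN1 hc2 hc1 hf2 hf1 hu₂ hv₂ hu₁ hv₁
  · exfalso
    obtain rfl := heq hN1 hN2
    have hqT : q ∉ T₁ := fun h => G.irrefl ((hN1 q).2 h)
    have hl1' : u₁' = u₁ := hl1.resolve_right fun h => hqT (h.1 ▸ hu₁)
    have hl2' : u₂' = u₂ := hl2.resolve_right fun h => hqT (h.1 ▸ hu₂)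
    rcases hD.two_covBy_lower hpq hT₁ hN1 hc1 hc2 hne' hu₁ hv₁ hu₂ hv₂ with ⟨h, h'⟩ | ⟨h, h'⟩
    · refine ht1 ⟨Subtype.ext (h.trans hl2'), (edgeContract_adj_of_adj_right h' ?_ ?_).symm⟩
      · rw [← h', ← hl1']
        rintro h''
        rw [h''] at hc1
        exact hc1.lt.asymm (h ▸ hc2.lt)
      · rw [hN1, ← hl1']
        exact hu₁
    · refine ht2 ⟨Subtype.ext (h.trans hl1'), (edgeContract_adj_of_adj_right h' ?_ ?_).symm⟩
      · rw [← h', ← hl2']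
        rintro h''
        rw [h''] at hc2
        exact hc2.lt.asymm (h ▸ hc1.lt)
      · rw [hN1, ← hl2']
        exact hu₂

/-- The solid edge `PQ` lifts into the neighbourhood of `p` or of `q`, so the contracted vertex
would be a common neighbour of `P` and `Q`, which do not have any. If the contracted vertex is `P`
or `Q`, the tree order and the nonsolid tree edges at `p` or `q` give the contradiction. -/
theorem DFSOrder.not_prismOrder_contract (hG : ThreeConnected G) (hD : DFSOrder G r)
    (hpq : p ⋖ q) (hs : Solid G p q)
    (hN : ∀ u v : V, u ⋖ v → v ≠ q → ¬ Solid G u v) {a b P Q c d : {v : V // v ≠ q}}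
    (hH : PrismOrder (edgeContract G p q) a b P Q c d) : False := by
  have hpqa := hD.adj_of_covBy hpq
  obtain ⟨u, huQ, hl⟩ := hD.covBy_lift hpq hH.pq
  have hf := fragile_of_solid_edgeContract hpqa hs hH.solid hl
  obtain ⟨T, hT, hu, hQ, hNT⟩ := hf.exists_adj_iff hG (hN _ _ huQ Q.2)
  have hPQ : P.1 < Q.1 := hH.pq.lt
  have key : P.1 ≠ p → Q.1 ≠ p → (G.Adj p P ∨ G.Adj q P) → (G.Adj p Q ∨ G.Adj q Q) → False := by
    intro hPp hQp h1 h2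
    have aux : ∀ x : {v : V // v ≠ q}, x.1 ≠ p → (G.Adj p x ∨ G.Adj q x) →
        (edgeContract G p q).Adj x ⟨p, hpq.ne⟩ := by
      rintro x hx (h | h)
      · exact (edgeContract_adj_of_adj h).symm
      · exact (edgeContract_adj_of_adj_right (u := ⟨p, hpq.ne⟩) rfl hx h).symm
    exact hH.not_adj (aux P hPp h1) (aux Q hQp h2)
  rcases hNT with hNT | hNT
  · have hpT : p ∉ T := fun h => G.irrefl ((hNT p).2 h)
    have hQp : Q.1 ≠ p := fun h => hpT (h ▸ hQ)
    rcases hl with rfl | ⟨rfl, hPp⟩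
    · exact key (fun h => hpT (h ▸ hu)) hQp (Or.inl ((hNT _).2 hu)) (Or.inl ((hNT _).2 hQ))
    · have hbp : b.1 < p := hPp ▸ hH.bp.lt
      obtain ⟨e, hep⟩ := hD.exists_covBy (v := p) (fun h => (hD.root_le b.1).not_gt (h ▸ hbp))
      have heT := (hNT e).1 (hD.adj_of_covBy hep).symm
      have hueq : e ≠ u := fun h => (h ▸ hep.lt).asymm hpq.lt
      have heQ : e ≠ Q := fun h => (h ▸ hep.lt).asymm (hpq.lt.trans huQ.lt)
      obtain ⟨x, hxe, hxu, hx⟩ := exists_third hT heT hu hueq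
      have hxQ : Q.1 = x := by
        rcases (hx Q).1 hQ with h | h | h
        · exact (heQ h.symm).elim
        · exact (huQ.ne h.symm).elim
        · exact h
      exact not_adj_of_not_solid hG (fun h => hN e p hep hpq.ne h.symm)
        (fun w => (hNT w).trans (hx w)) (hxQ ▸ hD.adj_of_covBy huQ)
  · have hqT : q ∉ T := fun h => G.irrefl ((hNT q).2 h)
    have hl' : u = P := hl.resolve_right fun h => hqT (h.1 ▸ hu)
    subst hl'
    have hpT := (hNT p).1 hpqa.symm
    by_cases hPp : P.1 = p
    · rcases hD.comparable ((hNT Q).2 hQ) with h | h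
      · exact huQ.2 (hPp ▸ hpq.lt) (lt_of_le_of_ne h (Ne.symm Q.2))
      · exact (hPp ▸ hPQ).not_ge (hD.le_of_lt_of_covBy (lt_of_le_of_ne h Q.2) hpq)
    by_cases hQp : Q.1 = p
    · obtain ⟨y, hqy, hyp, hyP⟩ := hG.exists_adj_ne q p P
      have hyadj := edgeContract_adj_of_adj_right (u := Q) (v := ⟨y, hqy.ne'⟩) hQp hyp hqy
      have hpy : p < y := by
        rcases (hH.adj_q _).1 hyadj with h | h | h
        · exact hQp ▸ (show Q < ⟨y, _⟩ from h ▸ hH.qc.lt)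
        · exact hQp ▸ (show Q < ⟨y, _⟩ from h ▸ hH.qc.lt.trans hH.cd.lt)
        · exact (hyP (congrArg Subtype.val h)).elim
      have hqy' : q < y := by
        rcases hD.comparable hqy with h | h
        · exact lt_of_le_of_ne h hqy.ne
        · exact (hpy.not_ge (hD.le_of_lt_of_covBy (lt_of_le_of_ne h hqy.ne') hpq)).elim
      obtain ⟨z, hqz, -⟩ := exists_covBy_le_of_lt hqy'
      have hzT := (hNT z).1 (hD.adj_of_covBy hqz)
      have hpz : p < z := hpq.lt.trans hqz.lt
      obtain ⟨x, hxz, hxp, hx⟩ := exists_third hT hzT hpT hpz.ne'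
      have hPx : P.1 = x := by
        rcases (hx P).1 hu with h | h | h
        · exact ((hQp ▸ hPQ).asymm (h ▸ hpz)).elim
        · exact (hPp h).elim
        · exact h
      exact not_adj_of_not_solid hG (hN q z hqz hqz.lt.ne') (fun w => (hNT w).trans (hx w))
        (hPx ▸ hQp ▸ (hD.adj_of_covBy huQ).symm)
    · exact key hPp hQp (Or.inr ((hNT _).2 hu)) (Or.inr ((hNT _).2 hQ))

end Unique

/-! ### Two solid tree edges in a triangle. -/

section Triangle

set_option linter.unusedSectionVars false

variable {V : Type*} [PartialOrder V] [Finite V] {G : SimpleGraph V} {r t s p u v : V}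
  {T : Finset V}

theorem DFSOrder.covBy_in_nbhd_mid (hD : DFSOrder G r) (hts : t ⋖ s) (hsp : s ⋖ p)
    (hT : T.card = 3) (hs : ∀ w, G.Adj s w ↔ w ∈ T) (huv : u ⋖ v) (hu : u ∈ T) (hv : v ∈ T) :
    ∃ c, (∀ w, G.Adj s w ↔ w = t ∨ w = p ∨ w = c) ∧ ((u = c ∧ v = t) ∨ (u = p ∧ v = c)) := by
  have htT : t ∈ T := (hs t).1 (hD.adj_of_covBy hts).symm
  have hpT : p ∈ T := (hs p).1 (hD.adj_of_covBy hsp)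
  have hsT : s ∉ T := fun h => G.irrefl ((hs s).2 h)
  have htp : t < p := hts.lt.trans hsp.lt
  obtain ⟨c, hct, hcp, hc⟩ := exists_third hT htT hpT htp.ne
  refine ⟨c, fun w => (hs w).trans (hc w), ?_⟩
  rcases (hc u).1 hu with rfl | rfl | rfl
  · exfalso
    rcases (hc v).1 hv with rfl | rfl | rfl
    · exact huv.ne rfl
    · exact huv.2 hts.lt hsp.lt
    · have hvs : v ≠ s := fun h => hsT (h ▸ hv)
      rcases hD.comparable ((hs v).2 hv) with h | h
      · exact huv.2 hts.lt (lt_of_le_of_ne h hvs.symm)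
      · exact huv.lt.not_ge (hD.le_of_lt_of_covBy (lt_of_le_of_ne h hvs) hts)
  · rcases (hc v).1 hv with rfl | rfl | rfl
    · exact (htp.asymm huv.lt).elim
    · exact (huv.ne rfl).elim
    · exact Or.inr ⟨rfl, rfl⟩
  · rcases (hc v).1 hv with rfl | rfl | rfl
    · exact Or.inl ⟨rfl, rfl⟩
    · exact (hsT (hD.eq_of_covBy hsp huv ▸ hu)).elim
    · exact (huv.ne rfl).elim

theorem DFSOrder.covBy_in_nbhd_lower (hD : DFSOrder G r) (hts : t ⋖ s) (hsp : s ⋖ p)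
    (htp : G.Adj t p) (hT : T.card = 3) (hp : ∀ w, G.Adj p w ↔ w ∈ T) (huv : u ⋖ v) (hvs : v ≠ s)
    (hu : u ∈ T) (hv : v ∈ T) : v = t := by
  have htT : t ∈ T := (hp t).1 htp.symm
  have hsT : s ∈ T := (hp s).1 (hD.adj_of_covBy hsp).symm
  have hpT : p ∉ T := fun h => G.irrefl ((hp p).2 h)
  by_contra hvt
  have hvp : v ≠ p := fun h => hpT (h ▸ hv)
  obtain ⟨c, hct, hcs, hc⟩ := exists_third hT htT hsT hts.ne
  have hvc : v = c := by
    rcases (hc v).1 hv with h | h | h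
    · exact (hvt h).elim
    · exact (hvs h).elim
    · exact h
  have hcomp := hD.comparable ((hp v).2 hv)
  rcases (hc u).1 hu with rfl | rfl | rfl
  · rcases hcomp with h | h
    · exact huv.2 hts.lt (hsp.lt.trans_le h)
    · have h1 := hD.le_of_lt_of_covBy (lt_of_le_of_ne h hvp) hsp
      exact huv.lt.not_ge (hD.le_of_lt_of_covBy (lt_of_le_of_ne h1 hvs) hts)
  · rcases hcomp with h | h
    · exact huv.2 hsp.lt (lt_of_le_of_ne h hvp.symm)
    · exact huv.lt.not_ge (hD.le_of_lt_of_covBy (lt_of_le_of_ne h hvp) hsp)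
  · exact huv.ne hvc.symm

theorem DFSOrder.covBy_in_nbhd_upper (hD : DFSOrder G r) (hts : t ⋖ s) (hsp : s ⋖ p)
    (htp : G.Adj t p) (hT : T.card = 3) (ht : ∀ w, G.Adj t w ↔ w ∈ T) (huv : u ⋖ v) (hvp : v ≠ p)
    (hu : u ∈ T) (hv : v ∈ T) :
    t = r ∧ (u = s ∨ u = p) ∧ ∀ w, G.Adj t w ↔ w = s ∨ w = p ∨ w = v := by
  have hsT : s ∈ T := (ht s).1 (hD.adj_of_covBy hts)
  have hpT : p ∈ T := (ht p).1 htp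
  have htT : t ∉ T := fun h => G.irrefl ((ht t).2 h)
  have hvs : v ≠ s := by
    rintro rfl
    exact htT (hD.eq_of_covBy hts huv ▸ hu)
  obtain ⟨c, hcs, hcp, hc⟩ := exists_third hT hsT hpT hsp.ne
  have hvc : v = c := by
    rcases (hc v).1 hv with h | h | h
    · exact (hvs h).elim
    · exact (hvp h).elim
    · exact h
  subst hvc
  have hu' : u = s ∨ u = p := by
    rcases (hc u).1 hu with h | h | h
    · exact Or.inl h
    · exact Or.inr h
    · exact (huv.ne h).elim
  refine ⟨?_, hu', fun w => (ht w).trans (hc w)⟩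
  have hsv : s < v := by
    rcases hu' with rfl | rfl
    · exact huv.lt
    · exact hsp.lt.trans huv.lt
  by_contra htr
  obtain ⟨e, het⟩ := hD.exists_covBy htr
  rcases (hc e).1 ((ht e).1 (hD.adj_of_covBy het).symm) with rfl | rfl | rfl
  · exact het.lt.asymm hts.lt
  · exact het.lt.asymm (hts.lt.trans hsp.lt)
  · exact het.lt.asymm (hts.lt.trans hsv)

/-- The tree edges that become solid when the lower one of two solid tree edges `ts`, `sp` in a
triangle is contracted. -/
theorem DFSOrder.fragile_lower (hG : ThreeConnected G) (hD : DFSOrder G r) (hts : t ⋖ s)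
    (hsp : s ⋖ p) (htp : G.Adj t p) (hN : ∀ u v : V, u ⋖ v → v ≠ s → v ≠ p → ¬ Solid G u v)
    (huv : u ⋖ v) (hvs : v ≠ s) (hvp : v ≠ p) (hf : Fragile G s p u v) :
    (v = t ∧ (G.Adj s u ∨ G.Adj p u)) ∨ ∀ d, G.Adj s d → d ≠ t → d ≠ p → s < d := by
  obtain ⟨T, hT, hu, hv, h | h⟩ := hf.exists_adj_iff hG (hN u v huv hvs hvp)
  · obtain ⟨c, hc, ⟨rfl, rfl⟩ | ⟨rfl, rfl⟩⟩ := hD.covBy_in_nbhd_mid hts hsp hT h huv hu hv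
    · exact Or.inl ⟨rfl, Or.inl ((h _).2 hu)⟩
    · right
      intro d hd hdt hdp
      have : d = v := by
        have := (hc d).1 hd
        tauto
      exact this ▸ hsp.lt.trans huv.lt
  · exact Or.inl ⟨hD.covBy_in_nbhd_lower hts hsp htp hT h huv hvs hu hv, Or.inr ((h _).2 hu)⟩

theorem DFSOrder.fragile_upper (hG : ThreeConnected G) (hD : DFSOrder G r) (hts : t ⋖ s)
    (hsp : s ⋖ p) (htp : G.Adj t p) (hN : ∀ u v : V, u ⋖ v → v ≠ s → v ≠ p → ¬ Solid G u v)
    (huv : u ⋖ v) (hvs : v ≠ s) (hvp : v ≠ p) (hf : Fragile G t s u v) :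
    (∀ d, G.Adj s d → d ≠ t → d ≠ p → d < t) ∨
      (u = p ∧ ∀ w, G.Adj s w ↔ w = t ∨ w = p ∨ w = v) ∨
      (u = p ∧ t = r ∧ ∀ w, G.Adj t w ↔ w = s ∨ w = p ∨ w = v) := by
  obtain ⟨T, hT, hu, hv, h | h⟩ := hf.exists_adj_iff hG (hN u v huv hvs hvp)
  · obtain ⟨rfl, hus, hNt⟩ := hD.covBy_in_nbhd_upper hts hsp htp hT h huv hvp hu hv
    rcases hus with rfl | rfl
    · exact (hD.not_siblings hG hts hsp huv hvp.symm).elim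
    · exact Or.inr (Or.inr ⟨rfl, rfl, hNt⟩)
  · obtain ⟨c, hc, ⟨rfl, rfl⟩ | ⟨rfl, rfl⟩⟩ := hD.covBy_in_nbhd_mid hts hsp hT h huv hu hv
    · left
      intro d hd hdt hdp
      have : d = u := by
        have := (hc d).1 hd
        tauto
      exact this ▸ huv.lt
    · exact Or.inr (Or.inl ⟨rfl, hc⟩)

/-- Otherwise a solid tree edge of the contraction is `ts`, or ends in `t` and starts at a neighbour
of the contracted vertex. Two of these form a path with adjacent ends. In a prism, the second kind
would put the solid edge in a triangle, and the first kind would make the further neighbours of `s`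
descendants after all. -/
theorem DFSOrder.lt_of_contract_lower (hG : ThreeConnected G) (hD : DFSOrder G r) (hts : t ⋖ s)
    (hsp : s ⋖ p) (htp : G.Adj t p) (hsol : Solid G s p)
    (hN : ∀ u v : V, u ⋖ v → v ≠ s → v ≠ p → ¬ Solid G u v)
    (hH : HasTwoSolid (edgeContract G s p) ∨
      ∃ a b P Q c d, PrismOrder (edgeContract G s p) a b P Q c d) :
    ∀ d, G.Adj s d → d ≠ t → d ≠ p → s < d := by
  have hspa := hD.adj_of_covBy hsp
  have htp' : t < p := hts.lt.trans hsp.lt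
  have below : ∀ {u v : {v : V // v ≠ p}} {u' : V}, u' ⋖ v → u' = u ∨ (u' = p ∧ u.1 = s) →
      v.1 ≤ s → u' = u := by
    intro u v u' h1 h2 h3
    refine h2.resolve_right fun h => ?_
    exact (h1.lt.trans_le h3).asymm (h.1 ▸ hsp.lt)
  by_contra hcon
  rcases hH with ⟨u₁, v₁, u₂, v₂, h1, h2, hs1, hs2, hne, ht1, ht2⟩ | ⟨a, b, P, Q, c, d, hP⟩
  · have key : ∀ {u v : {v : V // v ≠ p}}, u ⋖ v → Solid (edgeContract G s p) u v →
        (v.1 = s ∧ u.1 = t) ∨ (v.1 = t ∧ u < v ∧ (G.Adj s u ∨ G.Adj p u)) := by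
      intro u v huv hs
      obtain ⟨u', hu', hl⟩ := hD.covBy_lift hsp huv
      by_cases hvs : v.1 = s
      · left
        exact ⟨hvs, (below hu' hl hvs.le).symm.trans (hD.eq_of_covBy (hvs ▸ hu') hts)⟩
      · right
        have hf := fragile_of_solid_edgeContract hspa hsol hs hl
        have h := (hD.fragile_lower hG hts hsp htp hN hu' hvs v.2 hf).resolve_right hcon
        have huu := below hu' hl (h.1 ▸ hts.le)
        exact ⟨h.1, huv.lt, huu ▸ h.2⟩
    have fin : ∀ {u₁ v₁ u₂ v₂ : {v : V // v ≠ p}}, v₁.1 = s → u₁.1 = t → v₂.1 = t → u₂ < v₂ →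
        (G.Adj s u₂ ∨ G.Adj p u₂) → v₂ = u₁ ∧ (edgeContract G s p).Adj u₂ v₁ := by
      intro u₁ v₁ u₂ v₂ hv1 hu1 hv2 hlt hadj
      refine ⟨Subtype.ext (hv2.trans hu1.symm), ?_⟩
      rcases hadj with h | h
      · exact (edgeContract_adj_of_adj (hv1 ▸ h)).symm
      · refine (edgeContract_adj_of_adj_right hv1 ?_ h).symm
        have h3 : u₂.1 < v₂.1 := hlt
        exact (h3.trans (hv2 ▸ hts.lt)).ne
    rcases key h1 hs1 with ⟨hv1, hu1⟩ | ⟨hv1, hlt1, ha1⟩ <;>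
      rcases key h2 hs2 with ⟨hv2, hu2⟩ | ⟨hv2, hlt2, ha2⟩
    · exact hne (Subtype.ext (hv1.trans hv2.symm))
    · exact ht2 (fin hv1 hu1 hv2 hlt2 ha2)
    · exact ht1 (fin hv2 hu2 hv1 hlt1 ha1)
    · exact hne (Subtype.ext (hv1.trans hv2.symm))
  · obtain ⟨u', hu', hl⟩ := hD.covBy_lift hsp hP.pq
    have hPQ : P.1 < Q.1 := hP.pq.lt
    by_cases hQs : Q.1 = s
    · have hPt : P.1 = t := (below hu' hl hQs.le).symm.trans (hD.eq_of_covBy (hQs ▸ hu') hts)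
      refine hcon fun x hx hxt hxp => ?_
      have hadj : (edgeContract G s p).Adj Q ⟨x, hxp⟩ := edgeContract_adj_of_adj (hQs ▸ hx)
      rw [← hQs]
      rcases (hP.adj_q _).1 hadj with h | h | h
      · exact show Q < ⟨x, _⟩ from h ▸ hP.qc.lt
      · exact show Q < ⟨x, _⟩ from h ▸ hP.qc.lt.trans hP.cd.lt
      · exact (hxt ((congrArg Subtype.val h).trans hPt)).elim
    · have hf := fragile_of_solid_edgeContract hspa hsol hP.solid hl
      have h := (hD.fragile_lower hG hts hsp htp hN hu' hQs Q.2 hf).resolve_right hcon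
      have huP := below hu' hl (h.1 ▸ hts.le)
      have hQadj : (edgeContract G s p).Adj Q ⟨s, hsp.ne⟩ :=
        edgeContract_adj_of_adj (h.1 ▸ hD.adj_of_covBy hts)
      have hPs : P.1 ≠ s := (hPQ.trans (h.1 ▸ hts.lt)).ne
      refine hP.not_adj ?_ hQadj
      rcases h.2 with h' | h'
      · exact (edgeContract_adj_of_adj (huP ▸ h')).symm
      · exact (edgeContract_adj_of_adj_right (u := ⟨s, hsp.ne⟩) rfl hPs (huP ▸ h')).symm

/-- Otherwise a solid tree edge of the contraction is `tp`, or leads from `p` to a child adjacent to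
the contracted vertex. The new difficulty is a pair of edges of the second kind. -/
theorem DFSOrder.lt_of_contract_upper (hG : ThreeConnected G) (hD : DFSOrder G r) (hts : t ⋖ s)
    (hsp : s ⋖ p) (htp : G.Adj t p) (hsol : Solid G t s)
    (hN : ∀ u v : V, u ⋖ v → v ≠ s → v ≠ p → ¬ Solid G u v)
    (hH : HasTwoSolid (edgeContract G t s) ∨
      ∃ a b P Q c d, PrismOrder (edgeContract G t s) a b P Q c d) :
    ∀ d, G.Adj s d → d ≠ t → d ≠ p → d < t := by
  have htsa := hD.adj_of_covBy hts
  have htp' : t < p := hts.lt.trans hsp.lt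
  by_contra hcon
  have key : ∀ {u v : {v : V // v ≠ s}}, u ⋖ v → Solid (edgeContract G t s) u v →
      (v.1 = p ∧ u.1 = t) ∨ (u.1 = p ∧ p ⋖ v.1 ∧
        ((∀ w, G.Adj s w ↔ w = t ∨ w = p ∨ w = v) ∨
          (t = r ∧ ∀ w, G.Adj t w ↔ w = s ∨ w = p ∨ w = v))) := by
    intro u v huv hs
    obtain ⟨u', hu', hl⟩ := hD.covBy_lift hts huv
    by_cases hvp : v.1 = p
    · left
      refine ⟨hvp, ?_⟩
      have hus := hD.eq_of_covBy (hvp ▸ hu') hsp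
      rcases hl with hl | hl
      · exact (u.2 (hl.symm.trans hus)).elim
      · exact hl.2
    · right
      have hf := fragile_of_solid_edgeContract htsa hsol hs hl
      have h := (hD.fragile_upper hG hts hsp htp hN hu' v.2 hvp hf).resolve_left hcon
      have hup : u' = p := by tauto
      refine ⟨?_, hup ▸ hu', by tauto⟩
      rcases hl with hl | hl
      · exact hl.symm.trans hup
      · exact (hsp.ne (hl.1.symm.trans hup)).elim
  have adj_t : ∀ {u v : {v : V // v ≠ s}}, u.1 = t → p ⋖ v.1 →
      ((∀ w, G.Adj s w ↔ w = t ∨ w = p ∨ w = v) ∨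
          (t = r ∧ ∀ w, G.Adj t w ↔ w = s ∨ w = p ∨ w = v)) → (edgeContract G t s).Adj u v := by
    intro u v hu hv h
    rcases h with h | ⟨-, h⟩
    · exact edgeContract_adj_of_adj_right hu (htp'.trans hv.lt).ne' ((h _).2 (by simp))
    · exact edgeContract_adj_of_adj (by rw [hu, h]; simp)
  -- Here the third neighbour of `s` is `c` and that of the root `t` is `d`. The subtree at `c` has
  -- no neighbour `t`, so `{p, s}` cuts it off from `d`.
  have mixed : ∀ {c d : V}, p ⋖ c → p ⋖ d → c ≠ d → (∀ w, G.Adj s w ↔ w = t ∨ w = p ∨ w = c) →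
      t = r → (∀ w, G.Adj t w ↔ w = s ∨ w = p ∨ w = d) → False := by
    intro c d hpc hpd hcd hNs htr hNt
    have hcd' : ¬ c ≤ d := fun h => hpd.2 hpc.lt (lt_of_le_of_ne h hcd)
    refine hG.not_two_cut {x | c ≤ x} p s ?_ ⟨c, le_rfl, hpc.ne', (hsp.lt.trans hpc.lt).ne'⟩
      ⟨d, hcd', hpd.ne', (hsp.lt.trans hpd.lt).ne'⟩
    intro x (hx : c ≤ x) _ _ y hxy
    have hxt : x ≠ t := ((htp'.trans hpc.lt).trans_le hx).ne'
    rcases hD.comparable hxy with h | h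
    · exact Or.inl (hx.trans h)
    rcases hD.chain h hx with h' | h'
    · rcases h'.eq_or_lt with rfl | h'
      · exact Or.inl le_rfl
      rcases (hD.le_of_lt_of_covBy h' hpc).eq_or_lt with h1 | h1
      · exact Or.inr (Or.inl h1)
      rcases (hD.le_of_lt_of_covBy h1 hsp).eq_or_lt with h2 | h2
      · exact Or.inr (Or.inr h2)
      exfalso
      have hyt : y = t := le_antisymm (hD.le_of_lt_of_covBy h2 hts) (htr ▸ hD.root_le y)
      rcases (hNt x).1 (hyt ▸ hxy.symm) with rfl | rfl | rfl
      · exact (hsp.lt.trans hpc.lt).not_ge hx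
      · exact hpc.lt.not_ge hx
      · exact hcd' hx
    · exact Or.inl h'
  rcases hH with ⟨u₁, v₁, u₂, v₂, h1, h2, hs1, hs2, hne, ht1, ht2⟩ | ⟨a, b, P, Q, c, d, hP⟩
  · have hne' : v₁.1 ≠ v₂.1 := fun h => hne (Subtype.ext h)
    rcases key h1 hs1 with ⟨hv1, hu1⟩ | ⟨hu1, hc1, ha1⟩ <;>
      rcases key h2 hs2 with ⟨hv2, hu2⟩ | ⟨hu2, hc2, ha2⟩
    · exact hne' (hv1.trans hv2.symm)
    · exact ht1 ⟨Subtype.ext (hv1.trans hu2.symm), adj_t hu1 hc2 ha2⟩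
    · exact ht2 ⟨Subtype.ext (hv2.trans hu1.symm), adj_t hu2 hc1 ha1⟩
    · rcases ha1 with ha1 | ⟨htr, ha1⟩ <;> rcases ha2 with ha2 | ⟨htr', ha2⟩
      · rcases (ha2 v₁).1 ((ha1 v₁).2 (by simp)) with h | h | h
        · exact (htp'.trans hc1.lt).ne' h
        · exact hc1.ne' h
        · exact hne' h
      · exact mixed hc1 hc2 hne' ha1 htr' ha2
      · exact mixed hc2 hc1 hne'.symm ha2 htr ha1
      · rcases (ha2 v₁).1 ((ha1 v₁).2 (by simp)) with h | h | h
        · exact v₁.2 h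
        · exact hc1.ne' h
        · exact hne' h
  · rcases key hP.pq hP.solid with ⟨hQ, hPt⟩ | ⟨hPp, hc, ha⟩
    · refine hcon fun x hx hxt hxp => ?_
      have hadj : (edgeContract G t s).Adj P ⟨x, hx.ne'⟩ :=
        edgeContract_adj_of_adj_right hPt hxt hx
      rw [← hPt]
      rcases (hP.adj_p _).1 hadj with h | h | h
      · exact show (⟨x, _⟩ : {v : V // v ≠ s}) < P from h ▸ hP.bp.lt
      · exact show (⟨x, _⟩ : {v : V // v ≠ s}) < P from h ▸ hP.ab.lt.trans hP.bp.lt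
      · exact (hxp ((congrArg Subtype.val h).trans hQ)).elim
    · refine hP.not_adj (x := ⟨t, hts.ne⟩) ?_ (adj_t rfl hc ha).symm
      exact edgeContract_adj_of_adj (by rw [hPp]; exact htp.symm)

end Triangle

/-! ### The induction on the number of vertices. -/

section Main

theorem ThreeConnected.adj_of_card_eq_four {V : Type*} [Finite V] {G : SimpleGraph V}
    (hG : ThreeConnected G) (h4 : Nat.card V = 4) {x y : V} (hxy : x ≠ y) : G.Adj x y := by
  classical
  have := Fintype.ofFinite V
  rw [Nat.card_eq_fintype_card] at h4
  by_contra hadj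
  have h3 := hG.three_le_card {x} ((Finset.univ.erase x).erase y)
    (by
      rintro z rfl _ w hw
      right
      simp only [Finset.mem_erase, Finset.mem_univ, and_true]
      exact ⟨fun h => hadj (h ▸ hw), hw.ne'⟩)
    ⟨x, by simp⟩ ⟨y, by simp [hxy.symm]⟩
  rw [Finset.card_erase_of_mem (by simp [hxy.symm]), Finset.card_erase_of_mem (by simp),
    Finset.card_univ] at h3
  omega

/-- A separation of order three needs five vertices, so every pair is solid. The graph is complete,
hence the order is linear, and the first and last tree edges are disjoint. -/
theorem hasTwoSolid_of_card_eq_four {V : Type*} [PartialOrder V] [Finite V] {G : SimpleGraph V}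
    {r : V} (hG : ThreeConnected G) (hD : DFSOrder G r) (h4 : Nat.card V = 4) :
    HasTwoSolid G := by
  classical
  have solid : ∀ x y, Solid G x y := by
    intro x y A T B hS hT _ _
    have := Fintype.ofFinite V
    rw [Nat.card_eq_fintype_card] at h4
    have h := hS.card_inter Finset.univ
    have hA := Finset.card_pos.2 hS.left
    have hB := Finset.card_pos.2 hS.right
    simp only [Finset.inter_univ, Finset.card_univ] at h
    omega
  have total : ∀ x y : V, x ≤ y ∨ y ≤ x := by
    intro x y
    by_cases hxy : x = y
    · exact Or.inl hxy.le
    · exact hD.comparable (hG.adj_of_card_eq_four h4 hxy)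
  obtain ⟨m, -, hm⟩ := (wellFounded_gt (α := V)).has_min Set.univ ⟨r, trivial⟩
  have hm' : ∀ v, v ≤ m := by
    intro v
    rcases total v m with h | h
    · exact h
    · rcases h.eq_or_lt with h | h
      · exact h.ge
      · exact (hm v trivial h).elim
  obtain ⟨x, hxr, -⟩ := hG.exists_ne r r r
  have hrm : r < m := ((hD.eq_or_lt x).resolve_left hxr).trans_le (hm' x)
  obtain ⟨a, hra, -⟩ := exists_covBy_le_of_lt hrm
  obtain ⟨b, -, hbm⟩ := exists_le_covBy_of_lt hrm
  have ha : ∀ v, v ≠ r → a ≤ v := by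
    intro v hv
    rcases total a v with h | h
    · exact h
    · rcases h.eq_or_lt with h | h
      · exact h.ge
      · exact (hra.2 ((hD.eq_or_lt v).resolve_left hv) h).elim
  refine ⟨r, a, b, m, hra, hbm, solid _ _, solid _ _, ?_, ?_, ?_⟩
  · rintro rfl
    obtain ⟨y, hyr, hya, -⟩ := hG.exists_ne r a a
    exact hya (le_antisymm (hm' y) (ha y hyr))
  · rintro ⟨rfl, -⟩
    obtain ⟨y, hyr, hya, hym⟩ := hG.exists_ne r a m
    exact hya (le_antisymm (hD.le_of_lt_of_covBy (lt_of_le_of_ne (hm' y) hym) hbm) (ha y hyr))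
  · rintro ⟨h, -⟩
    exact hrm.ne' h

universe u

theorem hasTwoSolid_or_prismOrder (n : ℕ) : ∀ (V : Type u) [PartialOrder V] [Finite V]
    (G : SimpleGraph V) (r : V), Nat.card V = n → ThreeConnected G → DFSOrder G r →
    HasTwoSolid G ∨ ∃ a b p q c d, PrismOrder G a b p q c d := by
  induction n with
  | zero =>
    intro V _ _ G r hn hG _
    have := hG.four_le
    omega
  | succ n ih =>
    intro V _ _ G r hn hG hD
    by_cases h4 : Nat.card V = 4
    · exact Or.inl (hasTwoSolid_of_card_eq_four hG hD h4)
    have h5 : 5 ≤ Nat.card V := by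
      have := hG.four_le
      omega
    by_cases hgood : HasTwoSolid G
    · exact Or.inl hgood
    right
    have step : ∀ {p q : V}, p ⋖ q → Solid G p q → HasTwoSolid (edgeContract G p q) ∨
        ∃ a b P Q c d, PrismOrder (edgeContract G p q) a b P Q c d := by
      intro p q hpq hs
      have hcard := card_ne_add_one q
      exact ih _ _ ⟨r, ((hD.root_le p).trans_lt hpq.lt).ne⟩ (by omega)
        (hG.of_edgeContract h5 hpq.ne hs) (hD.of_edgeContract hpq _)
    have triangle : ∀ {t s p : V}, t ⋖ s → s ⋖ p → G.Adj t p → Solid G t s → Solid G s p →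
        False := by
      intro t s p hts hsp htp h1 h2
      -- A third solid tree edge would have to continue both `ts` and `sp` to a path, and no
      -- position allows this.
      have hN : ∀ u v : V, u ⋖ v → v ≠ s → v ≠ p → ¬ Solid G u v := by
        intro u v huv hvs hvp hs
        have e1 : s = u ∨ v = t := by
          by_contra! h
          exact hgood ⟨t, s, u, v, hts, huv, h1, hs, hvs.symm, fun h' => h.1 h'.1,
            fun h' => h.2 h'.1⟩
        have e2 : p = u := by
          by_contra h
          exact hgood ⟨s, p, u, v, hsp, huv, h2, hs, hvp.symm, fun h' => h h'.1,
            fun h' => hvs h'.1⟩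
        rcases e1 with e1 | e1
        · exact hsp.ne (e1.trans e2.symm)
        · exact (hts.lt.trans hsp.lt).asymm (e1 ▸ e2 ▸ huv.lt)
      -- The two contractions make the third neighbour of `s` both a descendant of `s` and an
      -- ancestor of `t`.
      obtain ⟨d, hsd, hdt, hdp⟩ := hG.exists_adj_ne s t p
      have g1 := hD.lt_of_contract_lower hG hts hsp htp h2 hN (step hsp h2) d hsd hdt hdp
      have g2 := hD.lt_of_contract_upper hG hts hsp htp h1 hN (step hts h1) d hsd hdt hdp
      exact (hts.lt.trans g1).asymm g2
    obtain ⟨p, q, hpq, hs⟩ := hD.exists_solid hG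
    -- With triangles excluded, any second solid tree edge would give `HasTwoSolid G`.
    have hN : ∀ u v : V, u ⋖ v → v ≠ q → ¬ Solid G u v := by
      intro u v huv hvq hs'
      by_cases e1 : q = u ∧ G.Adj p v
      · obtain ⟨rfl, hadj⟩ := e1
        exact triangle hpq huv hadj hs hs'
      by_cases e2 : v = p ∧ G.Adj u q
      · obtain ⟨rfl, hadj⟩ := e2
        exact triangle huv hpq hadj hs' hs
      exact hgood ⟨p, q, u, v, hpq, huv, hs, hs', hvq.symm, e1, e2⟩
    rcases step hpq hs with h | ⟨a, b, P, Q, c, d, h⟩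
    · obtain ⟨a, b, c, d, h⟩ := hD.prismOrder_of_contract hG h5 hpq hs hN h
      exact ⟨a, b, p, q, c, d, h⟩
    · exact (hD.not_prismOrder_contract hG hpq hs hN h).elim

end Main

/-! ### Separations against deletion of vertices, and the two forms of contraction. -/

section Connectivity

set_option linter.unusedSectionVars false

variable {V : Type*} [Finite V] {G : SimpleGraph V}

theorem IsKConnected.threeConnected (hG : IsKConnected 3 G) : ThreeConnected G where
  four_le := hG.1
  three_le A T B hS := by
    by_contra hlt
    have hc := hG.2 (T : Set V) (by rw [Set.ncard_coe_finset]; omega)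
    obtain ⟨a, ha⟩ := hS.left
    obtain ⟨b, hb⟩ := hS.right
    obtain ⟨w⟩ := hc.preconnected ⟨a, hS.not_mem_mid a ha⟩ ⟨b, hS.right_not_mem_mid b hb⟩
    have key : ∀ {x y : ((T : Set V)ᶜ : Set V)}, (G.induce (T : Set V)ᶜ).Walk x y → x.1 ∈ A →
        y.1 ∈ A := by
      intro x y w
      induction w with
      | nil => exact id
      | @cons a b c h _ ih =>
        intro hx
        exact ih ((hS.mem_or_mem hx h).resolve_right b.2)
    exact hS.not_mem_right b (key w ha) hb

theorem ThreeConnected.isKConnected (hG : ThreeConnected G) : IsKConnected 3 G := by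
  classical
  refine ⟨hG.four_le, fun T hT => ?_⟩
  have hfin : T.Finite := Set.toFinite T
  have hcard : hfin.toFinset.card < 3 := by rwa [← Set.ncard_eq_toFinset_card T hfin]
  rw [SimpleGraph.connected_iff]
  constructor
  · rintro ⟨u, hu⟩ ⟨v, hv⟩
    by_contra huv
    have := hG.three_le_card
      {x | ∃ h : x ∈ Tᶜ, (G.induce Tᶜ).Reachable ⟨u, hu⟩ ⟨x, h⟩} hfin.toFinset
      (by
        rintro x ⟨hx, hr⟩ - y hxy
        by_cases hy : y ∈ T
        · exact Or.inr (by simpa using hy)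
        · refine Or.inl ⟨hy, hr.trans (SimpleGraph.Adj.reachable ?_)⟩
          exact hxy)
      ⟨u, ⟨hu, SimpleGraph.Reachable.refl _⟩, by simpa using hu⟩
      ⟨v, fun ⟨_, h⟩ => huv h, by simpa using hv⟩
    omega
  · have := Fintype.ofFinite V
    have h4 := hG.four_le
    rw [Nat.card_eq_fintype_card] at h4
    have : hfin.toFinset.card < (Finset.univ : Finset V).card := by
      rw [Finset.card_univ]
      omega
    obtain ⟨v, -, hv⟩ := Finset.exists_mem_notMem_of_card_lt_card this
    exact ⟨⟨v, by simpa using hv⟩⟩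

theorem ThreeConnected.of_iso {W : Type*} {H : SimpleGraph W} (hG : ThreeConnected G)
    (e : G ≃g H) : ThreeConnected H where
  four_le := (Nat.card_congr e.toEquiv) ▸ hG.four_le
  three_le A T B hS := by
    have h : ∀ (S : Finset W) (v : V), v ∈ S.map e.symm.toEquiv.toEmbedding ↔ e v ∈ S := by
      intro S v
      rw [Finset.mem_map_equiv]
      rfl
    have := hG.three_le (A.map e.symm.toEquiv.toEmbedding) (T.map e.symm.toEquiv.toEmbedding)
      (B.map e.symm.toEquiv.toEmbedding)
      { left := hS.left.map
        right := hS.right.map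
        cover := fun v => by
          rw [h, h, h]
          exact hS.cover (e v)
        not_mem_mid := fun v => by
          rw [h, h]
          exact hS.not_mem_mid (e v)
        not_mem_right := fun v => by
          rw [h, h]
          exact hS.not_mem_right (e v)
        right_not_mem_mid := fun v => by
          rw [h, h]
          exact hS.right_not_mem_mid (e v)
        not_adj := fun u hu v hv huv => by
          rw [h] at hu hv
          exact hS.not_adj _ hu _ hv (e.map_adj_iff.2 huv) }
    rwa [Finset.card_map] at this

theorem nonempty_edgeContract_iso {p q : V} (hpq : p ≠ q) :
    Nonempty (edgeContract G p q ≃g contract G s(p, q)) := by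
  have hmk : ∀ u v : V, Quotient.mk (contractSetoid s(p, q)) u = Quotient.mk _ v ↔
      u = v ∨ ((u = p ∨ u = q) ∧ (v = p ∨ v = q)) := by
    intro u v
    rw [Quotient.eq]
    change (u = v ∨ (u ∈ s(p, q) ∧ v ∈ s(p, q))) ↔ _
    rw [Sym2.mem_iff, Sym2.mem_iff]
  have hval : ∀ u v : {v : V // v ≠ q}, Quotient.mk (contractSetoid s(p, q)) u.1 =
      Quotient.mk _ v.1 ↔ u = v := by
    intro u v
    rw [hmk, Subtype.ext_iff]
    have h1 := u.2
    have h2 := v.2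
    constructor
    · rintro (h | ⟨h | h, h' | h'⟩)
      · exact h
      · exact h.trans h'.symm
      · exact (h2 h').elim
      · exact (h1 h).elim
      · exact (h1 h).elim
    · exact Or.inl
  refine ⟨⟨Equiv.ofBijective (fun v : {v : V // v ≠ q} => Quotient.mk (contractSetoid s(p, q)) v.1)
    ⟨fun u v h => (hval u v).1 h, fun a => ?_⟩, ?_⟩⟩
  · induction a using Quotient.inductionOn with
    | h v =>
      by_cases hv : v = q
      · exact ⟨⟨p, hpq⟩, (hmk _ _).2 (Or.inr ⟨Or.inl rfl, Or.inr hv⟩)⟩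
      · exact ⟨⟨v, hv⟩, rfl⟩
  · intro u v
    change ((Quotient.mk (contractSetoid s(p, q)) u.1 ≠ Quotient.mk _ v.1) ∧ ∃ u' v' : V,
      Quotient.mk (contractSetoid s(p, q)) u' = Quotient.mk _ u.1 ∧
      Quotient.mk (contractSetoid s(p, q)) v' = Quotient.mk _ v.1 ∧ G.Adj u' v') ↔
      (u ≠ v ∧ (G.Adj u v ∨ (u.1 = p ∧ G.Adj q v) ∨ (v.1 = p ∧ G.Adj q u)))
    rw [Ne, hval]
    refine and_congr_right fun huv => ?_
    have hu := u.2
    have hv := v.2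
    have huv' : u.1 ≠ v.1 := fun h => huv (Subtype.ext h)
    constructor
    · rintro ⟨u', v', h1, h2, h⟩
      rw [hmk] at h1 h2
      have h1' : u' = u ∨ (u' = q ∧ u.1 = p) := by
        rcases h1 with h1 | ⟨h1 | h1, h1' | h1'⟩
        · exact Or.inl h1
        · exact Or.inl (h1.trans h1'.symm)
        · exact (hu h1').elim
        · exact Or.inr ⟨h1, h1'⟩
        · exact (hu h1').elim
      have h2' : v' = v ∨ (v' = q ∧ v.1 = p) := by
        rcases h2 with h2 | ⟨h2 | h2, h2' | h2'⟩
        · exact Or.inl h2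
        · exact Or.inl (h2.trans h2'.symm)
        · exact (hv h2').elim
        · exact Or.inr ⟨h2, h2'⟩
        · exact (hv h2').elim
      rcases h1' with rfl | ⟨rfl, h1'⟩ <;> rcases h2' with rfl | ⟨rfl, h2'⟩
      · exact Or.inl h
      · exact Or.inr (Or.inr ⟨h2', h.symm⟩)
      · exact Or.inr (Or.inl ⟨h1', h⟩)
      · exact (G.irrefl h).elim
    · rintro (h | ⟨h, h'⟩ | ⟨h, h'⟩)
      · exact ⟨u, v, rfl, rfl, h⟩
      · exact ⟨q, v, (hmk _ _).2 (Or.inr ⟨Or.inr rfl, Or.inl h⟩), rfl, h'⟩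
      · exact ⟨u, q, rfl, (hmk _ _).2 (Or.inr ⟨Or.inr rfl, Or.inl h⟩), h'.symm⟩

theorem Solid.isContractible (hG : ThreeConnected G) (h5 : 5 ≤ Nat.card V) {x y : V}
    (hxy : G.Adj x y) (hs : Solid G x y) : IsContractible 3 G s(x, y) := by
  obtain ⟨e⟩ := nonempty_edgeContract_iso (G := G) hxy.ne
  exact ⟨hxy, ((hG.of_edgeContract h5 hxy.ne hs).of_iso e).isKConnected⟩

end Connectivity

/-! ### From the branches of a DFS tree to the tree order. -/

section TreeOrder

open SimpleGraph

variable {V : Type*} {G Q : SimpleGraph V} {r : V}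

/-- The tree order of a tree `Q` with root `r`: `u ≤ v` if every walk from `r` to `v` meets `u`. -/
@[reducible]
def treeOrder (hQ : Q.IsTree) (r : V) : PartialOrder V where
  le u v := ∀ p : Q.Walk r v, u ∈ p.support
  le_refl _ p := p.end_mem_support
  le_trans u v w huv hvw p := by
    classical
    exact p.support_takeUntil_subset_support (hvw p) (huv _)
  le_antisymm u v huv hvu := by
    classical
    by_contra hne
    obtain ⟨p, hp⟩ := (hQ.existsUnique_path r v).exists
    exact Walk.endpoint_notMem_support_takeUntil hp (huv p) (Ne.symm hne) (hvu _)

/-- Every walk shortens to the unique path, so a single path decides the tree order. -/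
theorem mem_support_of_isPath (hQ : Q.IsTree) {u v : V} {p : Q.Walk r v} (hp : p.IsPath)
    (hu : u ∈ p.support) (q : Q.Walk r v) : u ∈ q.support := by
  classical
  have : q.bypass = p := (hQ.existsUnique_path r v).unique q.bypass_isPath hp
  exact q.support_bypass_subset_support (this ▸ hu)

theorem tree_le_total (hQ : Q.IsTree) {y z : V} (h : Q.Adj y z) :
    letI := treeOrder hQ r
    y ≤ z ∨ z ≤ y := by
  obtain ⟨p, hp⟩ := (hQ.existsUnique_path r y).exists
  by_cases hz : z ∈ p.support
  · exact Or.inr (mem_support_of_isPath hQ hp hz)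
  · left
    refine mem_support_of_isPath hQ (hp.concat hz h) ?_
    simp

theorem tree_eq_or_le (hQ : Q.IsTree) {x y z : V} (h : Q.Adj z y) :
    letI := treeOrder hQ r
    z ≤ y → x ≤ y → x = y ∨ x ≤ z := by
  intro hzy hxy
  obtain ⟨p, hp⟩ := (hQ.existsUnique_path r z).exists
  have hy : y ∉ p.support := by
    intro hy
    exact h.ne (letI := treeOrder hQ r; le_antisymm hzy (mem_support_of_isPath hQ hp hy))
  have hx := hxy (p.concat h)
  rw [Walk.support_concat, List.mem_append, List.mem_singleton] at hx
  rcases hx with hx | hx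
  · exact Or.inr (mem_support_of_isPath hQ hp hx)
  · exact Or.inl hx

theorem tree_chain (hQ : Q.IsTree) {u v w : V} :
    letI := treeOrder hQ r
    u ≤ w → v ≤ w → u ≤ v ∨ v ≤ u := by
  classical
  intro huw hvw
  obtain ⟨p, hp⟩ := (hQ.existsUnique_path r w).exists
  have hv := hvw p
  have hu := huw p
  rw [← p.take_spec hv, Walk.mem_support_append_iff] at hu
  rcases hu with hu | hu
  · exact Or.inl (mem_support_of_isPath hQ (hp.takeUntil hv) hu)
  · right
    have hpath : ((p.takeUntil v hv).append ((p.dropUntil v hv).takeUntil u hu)).IsPath := by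
      have h := hp
      rw [← p.take_spec hv, ← (p.dropUntil v hv).take_spec hu, Walk.append_assoc] at h
      exact h.of_append_left
    refine mem_support_of_isPath hQ hpath ?_
    rw [Walk.mem_support_append_iff]
    exact Or.inl (Walk.end_mem_support _)

theorem tree_adj_of_covBy (hQ : Q.IsTree) {u v : V} :
    letI := treeOrder hQ r
    u ⋖ v → Q.Adj u v := by
  let := treeOrder hQ r
  intro huv
  obtain ⟨p, hp⟩ := (hQ.existsUnique_path v r).exists
  have hle : u ≤ v := huv.le
  cases p with
  | nil => exact (huv.lt.not_ge fun q => q.start_mem_support).elim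
  | @cons _ w _ h p =>
    have hu := hle (Walk.cons h p).reverse
    rw [Walk.support_reverse, List.mem_reverse, Walk.support_cons, List.mem_cons] at hu
    have huw : u ≤ w := mem_support_of_isPath hQ hp.of_cons.reverse (by
      rw [Walk.support_reverse, List.mem_reverse]
      exact hu.resolve_left huv.ne)
    have hwv : w ≤ v := mem_support_of_isPath hQ hp.reverse (by simp)
    have : u = w := by
      by_contra hne
      exact huv.2 (lt_of_le_of_ne huw hne) (lt_of_le_of_ne hwv h.ne')
    exact this ▸ h.symm

/-- The only tree edge leaving the subtree at `c` goes to `x`. -/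
theorem tree_le_of_reachable (hQ : Q.IsTree) {x c : V} :
    letI := treeOrder hQ r
    x ⋖ c → ∀ {y z : ({x}ᶜ : Set V)}, (Q.induce ({x}ᶜ : Set V)).Reachable y z → c ≤ y.1 →
      c ≤ z.1 := by
  let := treeOrder hQ r
  rintro hxc y z ⟨w⟩ hy
  induction w with
  | nil => exact hy
  | @cons y z _ h _ ih =>
    refine ih ?_
    have hadj : Q.Adj y z := h
    rcases tree_le_total (r := r) hQ hadj with hyz | hzy
    · exact le_trans hy hyz
    · rcases tree_eq_or_le (r := r) hQ hadj.symm hzy hy with hcy | hcz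
      · exfalso
        rcases tree_eq_or_le (r := r) hQ hadj.symm hzy (hcy ▸ hxc.le) with h1 | h1
        · exact y.2 h1.symm
        · refine hxc.2 (c := z.1) (lt_of_le_of_ne h1 fun h' => z.2 h'.symm) ?_
          exact hcy ▸ lt_of_le_of_ne hzy hadj.ne'
      · exact hcz

/-- For adjacent incomparable `u` and `v`, let `x` be a maximal common ancestor. If both were in the
same `x`-branch, the child of `x` towards `u` would be a larger common ancestor; so they lie in
distinct branches, against the DFS property. -/
theorem IsDFSTree.dfsOrder [Finite V] (hD : IsDFSTree G Q r) :
    letI := treeOrder hD.isTree r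
    DFSOrder G r := by
  let := treeOrder hD.isTree r
  have hr : ∀ v, r ≤ v := fun v p => p.start_mem_support
  refine ⟨hr, tree_chain hD.isTree, fun h => hD.le (tree_adj_of_covBy hD.isTree h), ?_⟩
  intro u v huv
  by_contra! hcon
  obtain ⟨x, ⟨hxu, hxv⟩, hmax⟩ := (wellFounded_gt (α := V)).has_min {x | x ≤ u ∧ x ≤ v}
    ⟨r, hr u, hr v⟩
  have hxu' : x < u := lt_of_le_of_ne hxu fun h => hcon.1 (h ▸ hxv)
  have hxv' : x < v := lt_of_le_of_ne hxv fun h => hcon.2 (h ▸ hxu)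
  have branch : ∀ {y : V} (hy : x < y), IsBranch Q r x
      (Subtype.val '' ((Q.induce ({x}ᶜ : Set V)).connectedComponentMk ⟨y, hy.ne'⟩).supp) := by
    intro y hy
    refine ⟨?_, _, rfl⟩
    rintro ⟨z, hz, hzr⟩
    obtain ⟨c, hxc, hcy⟩ := exists_covBy_le_of_lt hy
    have h := tree_le_of_reachable hD.isTree hxc (ConnectedComponent.exact hz).symm hcy
    rw [hzr] at h
    exact hxc.lt.not_ge (h.trans (hr x))
  refine hD.not_adj x _ _ (branch hxu') (branch hxv') ?_ u ⟨⟨u, hxu'.ne'⟩, rfl, rfl⟩ v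
    ⟨⟨v, hxv'.ne'⟩, rfl, rfl⟩ huv
  intro heq
  have hv : v ∈ Subtype.val '' ((Q.induce ({x}ᶜ : Set V)).connectedComponentMk
      ⟨u, hxu'.ne'⟩).supp := by
    rw [heq]
    exact ⟨⟨v, hxv'.ne'⟩, rfl, rfl⟩
  obtain ⟨z, hz, hzv⟩ := hv
  obtain ⟨c, hxc, hcu⟩ := exists_covBy_le_of_lt hxu'
  have h := tree_le_of_reachable hD.isTree hxc (ConnectedComponent.exact hz).symm hcu
  rw [hzv] at h
  exact hmax c ⟨hcu, h⟩ hxc.lt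

end TreeOrder

/-! ### Recognising the prism. -/

section Prism

variable {V : Type*} {G : SimpleGraph V}

theorem nonempty_iso_of_bijective {W : Type*} {H : SimpleGraph W} (f : W → V)
    (hf : Function.Bijective f) (h : ∀ i j, G.Adj (f i) (f j) ↔ H.Adj i j) : Nonempty (G ≃g H) :=
  ⟨(RelIso.mk (Equiv.ofBijective f hf) (h _ _) : H ≃g G).symm⟩

/-- Only the pair `x₀`, `y₁` is left undecided. -/
theorem nonempty_iso_prism_or_prismPlus {x₀ x₁ x₂ y₀ y₁ y₂ : V}
    (hd : [x₀, x₁, x₂, y₀, y₁, y₂].Nodup)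
    (hc : ∀ v, v = x₀ ∨ v = x₁ ∨ v = x₂ ∨ v = y₀ ∨ v = y₁ ∨ v = y₂)
    (h01 : G.Adj x₀ x₁) (h02 : G.Adj x₀ x₂) (h12 : G.Adj x₁ x₂)
    (k01 : G.Adj y₀ y₁) (k02 : G.Adj y₀ y₂) (k12 : G.Adj y₁ y₂)
    (h0 : G.Adj x₀ y₀) (h1 : G.Adj x₁ y₁) (h2 : G.Adj x₂ y₂)
    (n02 : ¬ G.Adj x₀ y₂) (n10 : ¬ G.Adj x₁ y₀) (n12 : ¬ G.Adj x₁ y₂) (n20 : ¬ G.Adj x₂ y₀)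
    (n21 : ¬ G.Adj x₂ y₁) : Nonempty (G ≃g prism) ∨ Nonempty (G ≃g prismPlus) := by
  have m02 : ¬ G.Adj y₂ x₀ := fun h => n02 h.symm
  have m10 : ¬ G.Adj y₀ x₁ := fun h => n10 h.symm
  have m12 : ¬ G.Adj y₂ x₁ := fun h => n12 h.symm
  have m20 : ¬ G.Adj y₀ x₂ := fun h => n20 h.symm
  have m21 : ¬ G.Adj y₁ x₂ := fun h => n21 h.symm
  let f : Fin 3 × Fin 2 → V := fun i => ![![x₀, y₀], ![x₁, y₁], ![x₂, y₂]] i.1 i.2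
  have hf : Function.Bijective f := by
    constructor
    · simp only [List.nodup_cons, List.mem_cons, List.not_mem_nil, or_false, not_or] at hd
      rintro ⟨i, j⟩ ⟨i', j'⟩ h
      fin_cases i <;> fin_cases j <;> fin_cases i' <;> fin_cases j' <;> simp_all [f]
    · intro v
      rcases hc v with rfl | rfl | rfl | rfl | rfl | rfl
      exacts [⟨(0, 0), rfl⟩, ⟨(1, 0), rfl⟩, ⟨(2, 0), rfl⟩, ⟨(0, 1), rfl⟩, ⟨(1, 1), rfl⟩,
        ⟨(2, 1), rfl⟩]
  by_cases h : G.Adj x₀ y₁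
  · right
    refine nonempty_iso_of_bijective f hf ?_
    rintro ⟨i, j⟩ ⟨i', j'⟩
    fin_cases i <;> fin_cases j <;> fin_cases i' <;> fin_cases j' <;>
      simp [f, prismPlus, prism, SimpleGraph.boxProd_adj, SimpleGraph.edge_adj, h, h.symm,
        h01, h02, h12, k01, k02, k12, h0, h1, h2,
        h01.symm, h02.symm, h12.symm, k01.symm, k02.symm, k12.symm, h0.symm, h1.symm, h2.symm, n02,
        n10, n12, n20, n21, m02, m10, m12, m20, m21]
  · left
    have h' : ¬ G.Adj y₁ x₀ := fun h' => h h'.symm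
    refine nonempty_iso_of_bijective f hf ?_
    rintro ⟨i, j⟩ ⟨i', j'⟩
    fin_cases i <;> fin_cases j <;> fin_cases i' <;> fin_cases j' <;>
      simp [f, prism, SimpleGraph.boxProd_adj, h, h', h01, h02, h12, k01, k02, k12, h0, h1, h2,
        h01.symm, h02.symm, h12.symm, k01.symm, k02.symm, k12.symm, h0.symm, h1.symm, h2.symm, n02,
        n10, n12, n20, n21, m02, m10, m12, m20, m21]

end Prism

/-- The third neighbour `w` of `a` is `c` or `d`. Minimum degree three then gives the matching
between the triangles `abp` and `cdq`, and only the pair `b`, `w` stays open. -/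
theorem PrismOrder.nonempty_iso {V : Type*} [PartialOrder V] [Finite V] {G : SimpleGraph V}
    {a b p q c d : V} (hG : ThreeConnected G) (h : PrismOrder G a b p q c d)
    (hadj : ∀ {u v : V}, u ⋖ v → G.Adj u v) :
    Nonempty (G ≃g prism) ∨ Nonempty (G ≃g prismPlus) := by
  obtain ⟨w, hNa⟩ := h.adj_a
  obtain ⟨w', hNd⟩ := h.adj_d
  have hNp := h.adj_p
  have hNq := h.adj_q
  have h1 := h.ab.lt
  have h2 := h.bp.lt
  have h3 := h.pq.lt
  have h4 := h.qc.lt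
  have h5 := h.cd.lt
  have dab := h1.ne
  have dap := (h1.trans h2).ne
  have daq := (h1.trans (h2.trans h3)).ne
  have dac := (h1.trans (h2.trans (h3.trans h4))).ne
  have dad := (h1.trans (h2.trans (h3.trans (h4.trans h5)))).ne
  have dbp := h2.ne
  have dbq := (h2.trans h3).ne
  have dbc := (h2.trans (h3.trans h4)).ne
  have dbd := (h2.trans (h3.trans (h4.trans h5))).ne
  have dpq := h3.ne
  have dpc := (h3.trans h4).ne
  have dpd := (h3.trans (h4.trans h5)).ne
  have dqc := h4.ne
  have dqd := (h4.trans h5).ne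
  have dcd := h5.ne
  have naq : ¬ G.Adj q a := fun h => by simpa [dac, dad, dap] using (hNq a).1 h
  have nbq : ¬ G.Adj q b := fun h => by simpa [dbc, dbd, dbp] using (hNq b).1 h
  have ncp : ¬ G.Adj p c := fun h => by
    simpa [dbc.symm, dac.symm, dqc.symm] using (hNp c).1 h
  have ndp : ¬ G.Adj p d := fun h => by
    simpa [dbd.symm, dad.symm, dqd.symm] using (hNp d).1 h
  have hap : G.Adj a p := (hNa p).2 (by simp)
  have hdq : G.Adj d q := (hNd q).2 (by simp)
  have hw : w = c ∨ w = d := by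
    obtain ⟨y, hay, hyp, hyb⟩ := hG.exists_adj_ne a p b
    have hyw : y = w := (((hNa y).1 hay).resolve_left hyp).resolve_left hyb
    subst hyw
    rcases h.cover y with rfl | rfl | rfl | rfl | rfl | rfl
    · exact (G.irrefl hay).elim
    · exact (hyb rfl).elim
    · exact (hyp rfl).elim
    · exact (naq hay.symm).elim
    · exact Or.inl rfl
    · exact Or.inr rfl
  have hb : G.Adj b c ∨ G.Adj b d := by
    obtain ⟨y, hby, hya, hyp⟩ := hG.exists_adj_ne b a p
    rcases h.cover y with rfl | rfl | rfl | rfl | rfl | rfl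
    · exact (hya rfl).elim
    · exact (G.irrefl hby).elim
    · exact (hyp rfl).elim
    · exact (nbq hby.symm).elim
    · exact Or.inl hby
    · exact Or.inr hby
  have hc : G.Adj a c ∨ G.Adj b c := by
    obtain ⟨y, hcy, hyq, hyd⟩ := hG.exists_adj_ne c q d
    rcases h.cover y with rfl | rfl | rfl | rfl | rfl | rfl
    · exact Or.inl hcy.symm
    · exact Or.inr hcy.symm
    · exact (ncp hcy.symm).elim
    · exact (hyq rfl).elim
    · exact (G.irrefl hcy).elim
    · exact (hyd rfl).elim
  have hd : G.Adj a d ∨ G.Adj b d := by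
    obtain ⟨y, hdy, hyq, hyc⟩ := hG.exists_adj_ne d q c
    rcases h.cover y with rfl | rfl | rfl | rfl | rfl | rfl
    · exact Or.inl hdy.symm
    · exact Or.inr hdy.symm
    · exact (ndp hdy.symm).elim
    · exact (hyq rfl).elim
    · exact (hyc rfl).elim
    · exact (G.irrefl hdy).elim
  rcases hw with rfl | rfl
  · have nad : ¬ G.Adj a d := fun h => by
      simpa [dpd.symm, dbd.symm, dcd.symm] using (hNa d).1 h
    have hbd : G.Adj b d := hd.resolve_left nad
    have hac : G.Adj a w := (hNa w).2 (by simp)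
    refine nonempty_iso_prism_or_prismPlus (x₀ := b) (x₁ := a) (x₂ := p) (y₀ := d) (y₁ := w)
      (y₂ := q) ?_ ?_ (hadj h.ab).symm (hadj h.bp) hap (hadj h.cd).symm hdq (hadj h.qc).symm hbd
      hac (hadj h.pq) (fun h => nbq h.symm) nad (fun h => naq h.symm) ndp ncp
    · simp only [List.nodup_cons, List.mem_cons, List.not_mem_nil, or_false, not_or]
      simp [dbp, dbd, dbc, dbq, dap, dad, dac, daq, dpd, dpc, dpq, dab.symm, dqd.symm, dcd.symm,
        dqc.symm]
    · intro v
      have := h.cover v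
      clear * - this
      tauto
  · have nac : ¬ G.Adj a c := fun h => by
      simpa [dpc.symm, dbc.symm, dcd] using (hNa c).1 h
    have hbc : G.Adj b c := hc.resolve_left nac
    have haw : G.Adj a w := (hNa w).2 (by simp)
    have nbd : ¬ G.Adj b w := by
      intro h
      have e1 := (hNd a).1 haw.symm
      have e2 := (hNd b).1 h.symm
      exact dab (((e1.resolve_left daq).resolve_left dac).trans
        ((e2.resolve_left dbq).resolve_left dbc).symm)
    refine nonempty_iso_prism_or_prismPlus (x₀ := b) (x₁ := a) (x₂ := p) (y₀ := c) (y₁ := w)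
      (y₂ := q) ?_ ?_ (hadj h.ab).symm (hadj h.bp) hap (hadj h.cd) (hadj h.qc).symm hdq hbc
      haw (hadj h.pq) (fun h => nbq h.symm) nac (fun h => naq h.symm) ncp ndp
    · simp only [List.nodup_cons, List.mem_cons, List.not_mem_nil, or_false, not_or]
      simp [dbp, dbd, dbc, dbq, dap, dad, dac, daq, dpd, dpc, dpq, dab.symm, dcd, dqd.symm, dqc.symm]
    · intro v
      have := h.cover v
      clear * - this
      tauto

theorem ThreeConnected.nonempty_iso_top {V : Type*} [Finite V] {G : SimpleGraph V}
    (hG : ThreeConnected G) (h4 : Nat.card V = 4) :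
    Nonempty (G ≃g (⊤ : SimpleGraph (Fin 4))) := by
  refine ⟨⟨Finite.equivFinOfCardEq h4, ?_⟩⟩
  intro u v
  rw [SimpleGraph.top_adj, Ne, EmbeddingLike.apply_eq_iff_eq]
  exact ⟨fun h => hG.adj_of_card_eq_four h4 h, fun h => h.ne⟩

end Foxes

theorem theorem1 {V : Type*} [Finite V] (G Q : SimpleGraph V) (r : V)
    (hG : Foxes.IsKConnected 3 G)
    (hK4 : IsEmpty (G ≃g (⊤ : SimpleGraph (Fin 4))))
    (hQ : Foxes.IsDFSTree G Q r) :
    1 ≤ {e ∈ Q.edgeSet | Foxes.IsContractible 3 G e}.ncard ∧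
    (IsEmpty (G ≃g Foxes.prism) → IsEmpty (G ≃g Foxes.prismPlus) →
      2 ≤ {e ∈ Q.edgeSet | Foxes.IsContractible 3 G e}.ncard) := by
  let := Foxes.treeOrder hQ.isTree r
  have hG' := hG.threeConnected
  have hD : Foxes.DFSOrder G r := hQ.dfsOrder
  have h5 : 5 ≤ Nat.card V := by
    have h4 := hG'.four_le
    have : Nat.card V ≠ 4 := fun h => (not_isEmpty_iff.2 (hG'.nonempty_iso_top h)) hK4
    omega
  have mem : ∀ {u v : V}, u ⋖ v → Foxes.Solid G u v →
      s(u, v) ∈ {e ∈ Q.edgeSet | Foxes.IsContractible 3 G e} := fun huv hs =>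
    ⟨Foxes.tree_adj_of_covBy hQ.isTree huv, hs.isContractible hG' h5 (hD.adj_of_covBy huv)⟩
  constructor
  · obtain ⟨u, v, huv, hs⟩ := hD.exists_solid hG'
    exact (Set.ncard_pos (Set.toFinite _)).2 ⟨_, mem huv hs⟩
  · intro hprism hplus
    rcases Foxes.hasTwoSolid_or_prismOrder _ V G r rfl hG' hD with h | ⟨a, b, p, q, c, d, h⟩
    · obtain ⟨u₁, v₁, u₂, v₂, h1, h2, hs1, hs2, hne, -, -⟩ := h
      refine (Set.one_lt_ncard (Set.toFinite _)).2 ⟨_, mem h1 hs1, _, mem h2 hs2, fun heq => ?_⟩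
      rcases Sym2.eq_iff.1 heq with ⟨-, h⟩ | ⟨hu, hv⟩
      · exact hne h
      · exact h1.lt.asymm (hu ▸ hv ▸ h2.lt)
    · rcases h.nonempty_iso hG' hD.adj_of_covBy with he | he
      · exact (he.elim hprism.false).elim
      · exact (he.elim hplus.false).elim
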